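/- Let $Q$ be a finitely generated commutative monoid (written additively), $\Bbbk$ an arbitrary field, and $\Bbbk[Q]$ the monoid algebra with monomials $t^q$. **Definitions.** An element $x$ of a commutative monoid is *nil* if $q+x=x$ for all $q$, *nilpotent* if some multiple $nx$ $(n\ge 0)$ is nil, *cancellative* if $x+a=x+b\Rightarrow a=b$, and *partly cancellative* if $x+a=x+b$ not nil implies $a=b$ for all cancellative $a,b$. A *binomial ideal* is an ideal $I\subseteq\Bbbk[Q]$ generated by elements $t^p-\lambda t^q$ with $\lambda\in\Bbbk$ (possibly $0$); it induces the congruence $p\sim_I q\iff t^p-\lambda t^q\in I$ for some $\lambda\in\Bbbk^*$. A congruence $\sim$ is *mesoprimary* if every element of $Q/{\sim}$ is nilpotent or cancellative, and every element is partly cancellative. A binomial ideal $J$ is *mesoprimary* if it is maximal among the proper binomial ideals inducing a given mesoprimary congruence; it is *$P$-mesoprimary* for $P=\{q\in Q : t^{nq}\in J\text{ for some }n\}$. A *prime* of $Q$ is a proper, possibly empty, ideal $P\subsetneq Q$ such that $a+b\in P$ implies $a\in P$ or $b\in P$. Let $Q_P$ be the localization of $Q$ obtained by inverting the elements outside $P$,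 $G_P$ its group of units, $I_P$ the extension of $I$ to $\Bbbk[Q]_P=\Bbbk[Q_P]$, $\overline Q_P=Q_P/{\sim_{I_P}}$, and $\mathfrak m_P=\langle t^p : p\in P\rangle\subseteq\Bbbk[Q]_P$. An element $w\in Q$ is an *$I$-witness for $P$* if its image $\bar w\in\overline Q_P$ is not nil (for $P=\varnothing$ this is read as: $t^w\notin I_P$) and for every $p\in P$ there is $b\in\overline Q_P$ with $b\ne\bar w$ and $\bar p+b=\bar p+\bar w$. For a character $\rho:K\to\Bbbk^*$ of a subgroup $K\subseteq G_P$, let $I_\rho=\langle t^u-\rho(u-v)t^v : u,v\in G_P,\ u-v\in K\rangle\subseteq\Bbbk[Q]_P$; the *mesoprime* $I_{\rho,P}$ is the preimage of $I_\rho+\mathfrak m_P$ in $\Bbbk[Q]$. The *$P$-mesoprime of $I$ at $q$* is the preimage in $\Bbbk[Q]$ of $(I_P:t^q)+\mathfrak m_P$, and $\rho$ is the *character of $I_P$ at $q$* if $K$ is the stabilizer in $G_P$ of $\bar q\in\overline Q_P$ and $I_\rho+\mathfrak m_P=(I_P:t^q)+\mathfrak m_P$. An *associated mesoprime* of $I$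 is an ideal $I_{\rho,P}$ such that $\rho$ is the character of $I_P$ at some $I$-witness $w$ for $P$; then $w$ is an *$I$-witness for $I_{\rho,P}$*. For a set $W$ of such witnesses, the *component of $I$ cogenerated by $W$* is the preimage $C_W^P(I)$ in $\Bbbk[Q]$ of $I_P+I_\rho+\langle t^u : \bar w\notin\bar u+\overline Q_P\text{ for all }w\in W\rangle\subseteq\Bbbk[Q]_P$; it is *coprincipal* if $W$ is a single element. An element $w\in Q$ lies in the *$P$-socle* of $J$ if $t^w\notin J_P$ and $\mathfrak m_Pt^w\subseteq J_P$. An expression of $I$ as an intersection of finitely many mesoprimary ideals is a *mesoprimary decomposition* if, for every $P$-mesoprimary ideal $J$ in it, the $P$-mesoprimes of $I$ and $J$ at every element of the $P$-socle of $J$ coincide. It is *combinatorial* if moreover every element of the $P$-socle of every such $J$ is an $I$-witness for $P$. **Statement.** Every binomial ideal $I\subseteq\Bbbk[Q]$ has only finitely many associated mesoprimes, and it admits a combinatorial mesoprimary decomposition $I=\bigcap_{\mathfrak p}J_{\mathfrak p}$ with exactly one component $J_{\mathfrak p}$ for each associated mesoprime $\mathfrak p=I_{\rho,P}$ of $I$.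 Here $J_{\mathfrak p}$ is $P$-mesoprimary with $\mathfrak p$ as its only associated mesoprime, and it can be taken to be the component of $I$ cogenerated by a finite nonempty set $W$ of $I$-witnesses for $\mathfrak p$, which is the intersection of the coprincipal components of $I$ cogenerated by the elements $w\in W$. -/

import Mathlib

/-! Binomial ideals in monoid algebras `k[Q]`, for a commutative monoid `Q` written additively.
The monomial `t^q` is `AddMonoidAlgebra.single q 1`. -/

namespace Mesoprimary

open AddMonoidAlgebra

noncomputable section

/-! ### Monoids -/

section Monoid

variable {M : Type*} [AddCommMonoid M]

/-- `x` is a nil (absorbing element). -/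
def IsNil (x : M) : Prop := ∀ q : M, q + x = x

/-- Some multiple of `x` is nil. -/
def IsNilp (x : M) : Prop := ∃ n : ℕ, IsNil (n • x)

/-- Addition of `x` is injective. -/
def IsCanc (x : M) : Prop := ∀ a b : M, x + a = x + b → a = b

/-- `x + a = x + b ≠ ∞` implies `a = b`, for all cancellative `a`, `b`. -/
def IsPartlyCanc (x : M) : Prop :=
  ∀ a b : M, IsCanc a → IsCanc b → x + a = x + b → ¬ IsNil (x + a) → a = b

/-- Green's (divisibility) preorder: `x ≼ y` iff `⟨x⟩ ⊇ ⟨y⟩`. -/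
def GreenLE (x y : M) : Prop := ∃ u : M, u + x = y

/-- A mesoprimary congruence: every element of the quotient is nilpotent or cancellative, and every
element is partly cancellative. -/
def IsMesoprimaryCon (c : AddCon M) : Prop :=
  (∀ x : c.Quotient, IsNilp x ∨ IsCanc x) ∧ ∀ x : c.Quotient, IsPartlyCanc x

/-- A prime ideal of a commutative monoid: a proper subset, possibly empty, that is an ideal and
whose complement is closed under addition. -/
structure IsPrimeIdeal (P : Set M) : Prop where
  add_mem : ∀ q : M, ∀ p ∈ P, q + p ∈ P
  mem_or_mem : ∀ a b : M, a + b ∈ P → a ∈ P ∨ b ∈ P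
  zero_notMem : (0 : M) ∉ P

/-- The complement of a prime ideal, as a submonoid. -/
def IsPrimeIdeal.compl {P : Set M} (hP : IsPrimeIdeal P) : AddSubmonoid M where
  carrier := Pᶜ
  zero_mem' := hP.zero_notMem
  add_mem' := fun {a b} ha hb h => (hP.mem_or_mem a b h).elim ha hb

/-- The localization `Q_P`: formal differences `q - s` with `s ∉ P`. -/
abbrev Loc {P : Set M} (hP : IsPrimeIdeal P) : Type _ := AddLocalization hP.compl

/-- The localization morphism `Q → Q_P`. -/
def toLoc {P : Set M} (hP : IsPrimeIdeal P) : M →+ Loc hP :=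
  (AddLocalization.addMonoidOf hP.compl).toAddMonoidHom

end Monoid

/-! ### Binomial ideals and their congruences -/

section Binomial

variable {k : Type*} [Field k] {Q : Type*} [AddCommMonoid Q]

/-- The monomial `t^q`. -/
def mono (k : Type*) [Field k] {Q : Type*} (q : Q) : AddMonoidAlgebra k Q := single q 1

/-- `I` is generated by binomials `t^p - l t^q`, with `l ∈ k` possibly zero. -/
def IsBinomialIdeal (I : Ideal (AddMonoidAlgebra k Q)) : Prop :=
  ∃ S : Set (AddMonoidAlgebra k Q),
    (∀ f ∈ S, ∃ (p q : Q) (l : k), f = mono k p - l • mono k q) ∧ I = Ideal.span S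

theorem mono_add (p q : Q) : mono k (p + q) = mono k p * mono k q := by
  simp [mono, single_mul_single]

/-- The congruence induced by `I`: `p ∼ q` iff `t^p - l t^q ∈ I` for some unit `l`. -/
def inducedCon (I : Ideal (AddMonoidAlgebra k Q)) : AddCon Q where
  r p q := ∃ l : kˣ, mono k p - (l : k) • mono k q ∈ I
  iseqv := by
    refine ⟨fun p => ⟨1, by simp⟩, ?_, ?_⟩
    · rintro p q ⟨l, h⟩
      refine ⟨l⁻¹, ?_⟩
      have h2 : mono k q - ((l⁻¹ : kˣ) : k) • mono k p
          = -(((l⁻¹ : kˣ) : k) • (mono k p - (l : k) • mono k q)) := by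
        rw [smul_sub, smul_smul, Units.inv_mul, one_smul, neg_sub]
      rw [h2]
      exact I.neg_mem (Submodule.smul_of_tower_mem I _ h)
    · rintro p q r ⟨l, h⟩ ⟨m, h'⟩
      refine ⟨l * m, ?_⟩
      have h2 : mono k p - ((l * m : kˣ) : k) • mono k r
          = (mono k p - (l : k) • mono k q) + (l : k) • (mono k q - (m : k) • mono k r) := by
        rw [smul_sub, smul_smul, Units.val_mul]; abel
      rw [h2]
      exact I.add_mem h (Submodule.smul_of_tower_mem I _ h')
  add' := by
    rintro p q r s ⟨l, h⟩ ⟨m, h'⟩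
    refine ⟨l * m, ?_⟩
    have h2 : mono k (p + r) - ((l * m : kˣ) : k) • mono k (q + s)
        = mono k r * (mono k p - (l : k) • mono k q)
          + ((l : k) • mono k q) * (mono k r - (m : k) • mono k s) := by
      rw [mono_add, mono_add, Units.val_mul, mul_sub, mul_sub, mul_smul_comm, smul_mul_assoc,
        smul_mul_assoc, mul_smul_comm, smul_smul, mul_comm (mono k r) (mono k p),
        mul_comm (mono k r) (mono k q)]
      abel
    rw [h2]
    exact I.add_mem (I.mul_mem_left _ h) (I.mul_mem_left _ h')

/-- A mesoprimary ideal: maximal among the proper binomial ideals inducing a given mesoprimary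
congruence. -/
def IsMesoprimary (I : Ideal (AddMonoidAlgebra k Q)) : Prop :=
  IsBinomialIdeal I ∧ I ≠ ⊤ ∧ IsMesoprimaryCon (inducedCon I) ∧
    ∀ I' : Ideal (AddMonoidAlgebra k Q), IsBinomialIdeal I' → I' ≠ ⊤ →
      inducedCon I' = inducedCon I → I ≤ I' → I' = I

/-- A mesoprimary ideal is `P`-mesoprimary if `P` is the set of exponents of the monomials that are
nilpotent modulo it.  (By maximality this is the nilpotent ideal of the induced congruence, unless
that congruence is universal, when it is empty.) -/
def IsPMesoprimary (P : Set Q) (I : Ideal (AddMonoidAlgebra k Q)) : Prop :=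
  IsMesoprimary I ∧ P = {q : Q | ∃ n : ℕ, mono k (n • q) ∈ I}

/-! ### Monomial localization -/

variable {P : Set Q} (hP : IsPrimeIdeal P)

/-- The monomial localization map `k[Q] → k[Q]_P = k[Q_P]`. -/
def locMap (k : Type*) [Field k] : AddMonoidAlgebra k Q →+* AddMonoidAlgebra k (Loc hP) :=
  mapDomainRingHom k (toLoc hP)

/-- The extension `I_P` of `I` to `k[Q]_P`. -/
def locIdeal (I : Ideal (AddMonoidAlgebra k Q)) : Ideal (AddMonoidAlgebra k (Loc hP)) :=
  I.map (locMap hP k)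

/-- The ideal `m_P` of `k[Q]_P` generated by the monomials with exponent in `P`. -/
def maxMono (k : Type*) [Field k] : Ideal (AddMonoidAlgebra k (Loc hP)) :=
  Ideal.span ((fun p : Q => mono k (toLoc hP p)) '' P)

/-- The class of `q` in the quotient of `Q_P` by the congruence induced by `I_P`. -/
def locClass (I : Ideal (AddMonoidAlgebra k Q)) (q : Q) :
    (inducedCon (locIdeal hP I)).Quotient :=
  (inducedCon (locIdeal hP I)).mk' (toLoc hP q)

/-! ### Witnesses, characters and mesoprimes -/

/-- `w` is an `I`-witness for `P`: its class in the quotient of `Q_P` is not nil, and for each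
`p ∈ P` some other class becomes equal to it upon adding `p`.  For `P` empty the quotient of `Q_P`
is a group, where the only possible nil is the identity of the trivial group; in this case "not nil"
is read as `t^w ∉ I_P`, so that all elements are witnesses as soon as `I` contains no monomial.
(For `P` nonempty, `t^w ∉ I_P` follows from the class of `w` not being nil.) -/
def IsWitness (I : Ideal (AddMonoidAlgebra k Q)) (w : Q) : Prop :=
  mono k (toLoc hP w) ∉ locIdeal hP I ∧
  (P.Nonempty → ¬ IsNil (locClass hP I w)) ∧
  ∀ p ∈ P, ∃ b : (inducedCon (locIdeal hP I)).Quotient,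
    b ≠ locClass hP I w ∧ locClass hP I p + b = locClass hP I p + locClass hP I w

/-- The monomial `t^w` lies in the `P`-socle modulo `J`: it is nonzero in `k[Q]_P / J_P` and
annihilated there by `m_P`. -/
def InSocle (J : Ideal (AddMonoidAlgebra k Q)) (w : Q) : Prop :=
  mono k (toLoc hP w) ∉ locIdeal hP J ∧
  ∀ f ∈ maxMono hP k, f * mono k (toLoc hP w) ∈ locIdeal hP J

/-- The ideal `(I_P : t^q) + m_P` of `k[Q]_P`. -/
def locMesoprimeAt (I : Ideal (AddMonoidAlgebra k Q)) (q : Q) :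
    Ideal (AddMonoidAlgebra k (Loc hP)) :=
  (locIdeal hP I).colon {mono k (toLoc hP q)} ⊔ maxMono hP k

/-- The `P`-mesoprime of `I` at `q`: the preimage of `(I_P : t^q) + m_P` in `k[Q]`. -/
def mesoprimeAt (I : Ideal (AddMonoidAlgebra k Q)) (q : Q) : Ideal (AddMonoidAlgebra k Q) :=
  (locMesoprimeAt hP I q).comap (locMap hP k)

/-- The stabilizer of the class of `q` under the action of the group `G_P` of units of `Q_P`. -/
def stab (I : Ideal (AddMonoidAlgebra k Q)) (q : Q) : AddSubgroup (AddUnits (Loc hP)) where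
  carrier := {g | (inducedCon (locIdeal hP I)).mk' ((g : Loc hP) + toLoc hP q) = locClass hP I q}
  zero_mem' := by simp [locClass]
  add_mem' := by
    intro g h hg hh
    simp only [Set.mem_ofPred_eq, locClass, map_add, AddUnits.val_add] at hg hh ⊢
    rw [add_assoc, hh, hg]
  neg_mem' := by
    intro g hg
    simp only [Set.mem_ofPred_eq, locClass, map_add] at hg ⊢
    conv_lhs => rw [← hg]
    rw [← add_assoc, ← map_add, AddUnits.neg_add, map_zero, zero_add]

/-- The ideal of `k[Q]_P` generated by `t^u - ρ(u - v) t^v` for units `u`, `v` of `Q_P` with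
`u - v ∈ K`, where `ρ : K → kˣ` is a character of a subgroup `K` of `G_P`. -/
def charIdeal {K : AddSubgroup (AddUnits (Loc hP))} (ρ : Multiplicative K →* kˣ) :
    Ideal (AddMonoidAlgebra k (Loc hP)) :=
  Ideal.span {f | ∃ (u v : AddUnits (Loc hP)) (h : u - v ∈ K),
    f = mono k (u : Loc hP) - (ρ (Multiplicative.ofAdd ⟨u - v, h⟩) : k) • mono k (v : Loc hP)}

/-- The `P`-mesoprime of the character `ρ`. -/
def mesoprime {K : AddSubgroup (AddUnits (Loc hP))} (ρ : Multiplicative K →* kˣ) :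
    Ideal (AddMonoidAlgebra k Q) :=
  (charIdeal hP ρ ⊔ maxMono hP k).comap (locMap hP k)

/-- `ρ` is the character of `I_P` at `q`: its domain is the stabilizer of `q`, and
`(I_P : t^q) + m_P` is the localized mesoprime of `ρ`. -/
def IsCharAt (I : Ideal (AddMonoidAlgebra k Q)) (q : Q) {K : AddSubgroup (AddUnits (Loc hP))}
    (ρ : Multiplicative K →* kˣ) : Prop :=
  K = stab hP I q ∧ charIdeal hP ρ ⊔ maxMono hP k = locMesoprimeAt hP I q

/-- The associated mesoprimes of `I`: the mesoprimes `I_{ρ,P}` for which `ρ` is the character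
of `I_P` at some `I`-witness for `P`. -/
def assMesoprimes (I : Ideal (AddMonoidAlgebra k Q)) : Set (Ideal (AddMonoidAlgebra k Q)) :=
  {p | ∃ (P : Set Q) (hP : IsPrimeIdeal P) (K : AddSubgroup (AddUnits (Loc hP)))
    (ρ : Multiplicative K →* kˣ) (w : Q),
    IsWitness hP I w ∧ IsCharAt hP I w ρ ∧ p = mesoprime hP ρ}

/-! ### Components cogenerated by witnesses -/

/-- The order ideal cogenerated by `w` at `P`. -/
def orderIdeal (I : Ideal (AddMonoidAlgebra k Q)) (w : Q) : Set Q :=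
  {a | GreenLE (locClass hP I a) (locClass hP I w)}

/-- The monomial ideal cogenerated by the set `W` along `P`. -/
def cogenMono (I : Ideal (AddMonoidAlgebra k Q)) (W : Set Q) : Ideal (AddMonoidAlgebra k Q) :=
  Ideal.span ((fun u : Q => mono k u) '' {u | ∀ w ∈ W, u ∉ orderIdeal hP I w})

/-- The `P`-mesoprimary component of `I` cogenerated by the set `W` of elements at which the
character of `I_P` is `ρ`: the preimage in `k[Q]` of the sum of `I_P`, the ideal of `ρ`, and the
monomial ideal cogenerated by `W`.  For a singleton `W` it is a coprincipal component. -/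
def component (I : Ideal (AddMonoidAlgebra k Q)) {K : AddSubgroup (AddUnits (Loc hP))}
    (ρ : Multiplicative K →* kˣ) (W : Set Q) : Ideal (AddMonoidAlgebra k Q) :=
  (locIdeal hP I ⊔ charIdeal hP ρ ⊔ (cogenMono hP I W).map (locMap hP k)).comap (locMap hP k)

end Binomial

/-! ### Mesoprimary decompositions -/

section Decomposition

variable {k : Type*} [Field k] {Q : Type*} [AddCommMonoid Q]

/-- The finite family `J` is a mesoprimary decomposition of `I`: all `J i` are mesoprimary, their
intersection is `I`, and if `J i` is `P`-mesoprimary then the `P`-mesoprimes of `I` and `J i`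
coincide at every element of the `P`-socle of `J i`. -/
structure IsMesoprimaryDecomposition {ι : Type*} (I : Ideal (AddMonoidAlgebra k Q))
    (J : ι → Ideal (AddMonoidAlgebra k Q)) : Prop where
  finite : Finite ι
  inter : I = ⨅ i, J i
  mesoprimary : ∀ i, IsMesoprimary (J i)
  coincide : ∀ (i : ι) (P : Set Q) (hP : IsPrimeIdeal P), IsPMesoprimary P (J i) →
    ∀ w : Q, InSocle hP (J i) w → mesoprimeAt hP I w = mesoprimeAt hP (J i) w

/-- A mesoprimary decomposition is combinatorial if, for each `P`-mesoprimary component, all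
elements of its `P`-socle are `I`-witnesses for `P`. -/
structure IsCombinatorialDecomposition {ι : Type*} (I : Ideal (AddMonoidAlgebra k Q))
    (J : ι → Ideal (AddMonoidAlgebra k Q)) : Prop extends IsMesoprimaryDecomposition I J where
  witness : ∀ (i : ι) (P : Set Q) (hP : IsPrimeIdeal P), IsPMesoprimary P (J i) →
    ∀ w : Q, InSocle hP (J i) w → IsWitness hP I w

end Decomposition

end

end Mesoprimary

namespace Mesoprimary

open AddMonoidAlgebra

noncomputable section

/-! ### Linear algebra over the monomials -/

section Basics

variable {k : Type*} [Field k] {M : Type*} [AddCommMonoid M]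

/-! Modulo a binomial ideal `I`, a monomial congruent to `w` is a scalar multiple of `t^w`, and the
scalar is unique when `t^w ∉ I`. Hence the functional `classCoeff`, reading off the coefficient at
the class of `w`, is well defined and vanishes on `I`. On the other side, `exists_isReduced` brings
every element, modulo the binomials of `I`, to a normal form with pairwise incongruent monomials
outside `I`. A class functional sees only one term of a normal form, and most memberships below are
decided by playing these two facts against each other.

Let `ρ` be the character at `w`. The largest ideal in the kernel of the functional at `w`,
`classKernel`, contains `I_P`, `I_ρ` and every `t^x` with `x` not dividing `w`, hence the component
cogenerated by any set containing `w` whose members share the character `ρ`. This upper bound shows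
that forming the component creates no unwanted monomials or relations. For finite nonempty `W` the
component is therefore `P`-mesoprimary: elements outside `P` cancel, elements of `P` are nilpotent
by Dickson's lemma, and a unit fixing a class outside the component lies in `K`. Its socle consists
of associates of cogenerators, which are again witnesses with character `ρ`.

For the intersection, let `f ∉ I` and choose `q` with `(I : t^q f)` maximal. The monomials killing
`t^q f` modulo `I` form a prime `P`, so `t^q f` is a nonzero socle element modulo `I_P`. In its
normal form, a monomial `w` minimal for divisibility is a witness: being killed by `P` forces it to
merge with another term. The functional at `w` then separates `t^q f` from the coprincipal component
at `w`. Since `k[Q]` is Noetherian, finitely many witnesses suffice for each `P`. Since the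
mesoprime at `q` grows with `q`, there are finitely many associated mesoprimes. Grouping the
witnesses by mesoprime gives the decomposition. -/

theorem single_eq_smul_mono (u : M) (a : k) : single u a = a • mono k u := by
  simp [mono]

theorem mono_zero : mono k (0 : M) = 1 := rfl

theorem ksmul_mem {I : Ideal (AddMonoidAlgebra k M)} (a : k) {f : AddMonoidAlgebra k M}
    (hf : f ∈ I) : a • f ∈ I :=
  Submodule.smul_of_tower_mem I a hf

theorem mem_of_ksmul_mem {I : Ideal (AddMonoidAlgebra k M)} {a : k} (ha : a ≠ 0)
    {f : AddMonoidAlgebra k M} (hf : a • f ∈ I) : f ∈ I := by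
  simpa [smul_smul, ha] using ksmul_mem a⁻¹ hf

theorem mono_add_mem {I : Ideal (AddMonoidAlgebra k M)} {u : M} (v : M) (hu : mono k u ∈ I) :
    mono k (v + u) ∈ I := by
  rw [mono_add]; exact I.mul_mem_left _ hu

theorem mono_mul_binomial (r p q : M) (l : k) :
    mono k r * (mono k p - l • mono k q) = mono k (r + p) - l • mono k (r + q) := by
  rw [mono_add, mono_add, mul_sub, mul_smul_comm]

/-- A `k`-subspace containing all monomial multiples of a set contains the ideal it spans. -/
theorem mem_of_mem_span {S : Set (AddMonoidAlgebra k M)} (N : Submodule k (AddMonoidAlgebra k M))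
    (h : ∀ (r : M), ∀ s ∈ S, mono k r * s ∈ N) {f : AddMonoidAlgebra k M}
    (hf : f ∈ Ideal.span S) : f ∈ N := by
  suffices H : ∀ g : AddMonoidAlgebra k M, g * f ∈ N by simpa using H 1
  induction hf using Submodule.span_induction with
  | mem x hx =>
    intro g
    induction g using AddMonoidAlgebra.induction_linear with
    | zero => simp
    | add a b ha hb => rw [add_mul]; exact N.add_mem ha hb
    | single u a =>
      rw [single_eq_smul_mono, smul_mul_assoc]
      exact N.smul_mem _ (h u x hx)
  | zero => simp
  | add x y _ _ hx hy => intro g; rw [mul_add]; exact N.add_mem (hx g) (hy g)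
  | smul a x _ hx => intro g; rw [smul_eq_mul, ← mul_assoc]; exact hx _

theorem linearMap_apply_eq_sum {V : Type*} [AddCommGroup V] [Module k V]
    (T : AddMonoidAlgebra k M →ₗ[k] V) (f : AddMonoidAlgebra k M) :
    T f = ∑ u ∈ f.coeff.support, f.coeff u • T (mono k u) := by
  conv_lhs => rw [← sum_coeff_single f]
  rw [Finsupp.sum, map_sum]
  refine Finset.sum_congr rfl fun u _ => ?_
  rw [single_eq_smul_mono, map_smul]

/-- Used with a class functional and an element in normal form: a single term survives, so a
vanishing value contradicts `u` being in the support. -/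
theorem linearMap_apply_of_isolated {V : Type*} [AddCommGroup V] [Module k V]
    (T : AddMonoidAlgebra k M →ₗ[k] V) {f : AddMonoidAlgebra k M} {u : M}
    (h : ∀ v ∈ f.coeff.support, v ≠ u → T (mono k v) = 0) :
    T f = f.coeff u • T (mono k u) := by
  rw [linearMap_apply_eq_sum]
  refine Finset.sum_eq_single u (fun v hv hvu => by rw [h v hv hvu, smul_zero]) fun hu => ?_
  rw [Finsupp.notMem_support_iff.1 hu, zero_smul]

theorem mem_of_forall_mono_mem (N : Submodule k (AddMonoidAlgebra k M)) {f : AddMonoidAlgebra k M}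
    (h : ∀ v ∈ f.coeff.support, mono k v ∈ N) : f ∈ N := by
  have := linearMap_apply_eq_sum LinearMap.id f
  rw [LinearMap.id_apply] at this
  rw [this]
  exact N.sum_mem fun u hu => N.smul_mem _ (h u hu)

end Basics

/-! ### The congruence induced by an ideal -/

section Congruence

variable {k : Type*} [Field k] {M : Type*} [AddCommMonoid M]
  {I : Ideal (AddMonoidAlgebra k M)} {u v w : M}

theorem inducedCon_iff : inducedCon I u v ↔ ∃ l : kˣ, mono k u - (l : k) • mono k v ∈ I :=
  Iff.rfl

theorem inducedCon_mono {J : Ideal (AddMonoidAlgebra k M)} (h : I ≤ J) (huv : inducedCon I u v) :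
    inducedCon J u v := by
  obtain ⟨l, hl⟩ := huv
  exact ⟨l, h hl⟩

theorem mono_mem_of_rel (h : inducedCon I u v) (hv : mono k v ∈ I) : mono k u ∈ I := by
  obtain ⟨l, hl⟩ := h
  simpa using I.add_mem hl (ksmul_mem (l : k) hv)

theorem mono_mem_iff_of_rel (h : inducedCon I u v) : mono k u ∈ I ↔ mono k v ∈ I :=
  ⟨mono_mem_of_rel ((inducedCon I).symm h), mono_mem_of_rel h⟩

theorem rel_of_mono_mem (hu : mono k u ∈ I) (hv : mono k v ∈ I) : inducedCon I u v :=
  ⟨1, by simpa using I.sub_mem hu hv⟩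

theorem rel_add_left (x : M) (h : inducedCon I u v) : inducedCon I (x + u) (x + v) :=
  (inducedCon I).add ((inducedCon I).refl x) h

theorem rel_of_isAddUnit_add {x : M} (hx : IsAddUnit x) (h : inducedCon I (x + u) (x + v)) :
    inducedCon I u v := by
  obtain ⟨y, hy⟩ := isAddUnit_iff_exists_neg'.1 hx
  simpa [← add_assoc, hy] using rel_add_left y h

theorem mono_add_mem_iff {x : M} (hx : IsAddUnit x) : mono k (x + u) ∈ I ↔ mono k u ∈ I := by
  refine ⟨fun h => ?_, mono_add_mem x⟩
  obtain ⟨y, hy⟩ := isAddUnit_iff_exists_neg'.1 hx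
  simpa [← add_assoc, hy] using mono_add_mem y h

theorem mono_mul_mem_iff {x : M} (hx : IsAddUnit x) {f : AddMonoidAlgebra k M} :
    mono k x * f ∈ I ↔ f ∈ I := by
  refine ⟨fun h => ?_, I.mul_mem_left _⟩
  obtain ⟨y, hy⟩ := isAddUnit_iff_exists_neg'.1 hx
  simpa [← mul_assoc, ← mono_add, hy, mono_zero] using I.mul_mem_left (mono k y) h

theorem scalar_unique (hw : mono k w ∉ I) {a b : k} (ha : mono k u - a • mono k w ∈ I)
    (hb : mono k u - b • mono k w ∈ I) : a = b := by
  by_contra hab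
  refine hw (mem_of_ksmul_mem (sub_ne_zero.2 hab) ?_)
  have := I.sub_mem hb ha
  rwa [sub_sub_sub_cancel_left, ← sub_smul] at this

theorem isNil_mk_iff {c : AddCon M} : IsNil (c.mk' w) ↔ ∀ x : M, c (x + w) w := by
  refine ⟨fun h x => ?_, fun h q => ?_⟩
  · exact c.eq.1 (h (c.mk' x))
  · obtain ⟨x, rfl⟩ := AddCon.mk'_surjective q
    exact c.eq.2 (h x)

theorem isNil_of_mono_mem (hw : mono k w ∈ I) : IsNil ((inducedCon I).mk' w) :=
  isNil_mk_iff.2 fun x => rel_of_mono_mem (mono_add_mem x hw) hw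

theorem greenLE_mk_iff {c : AddCon M} : GreenLE (c.mk' u) (c.mk' w) ↔ ∃ x : M, c (x + u) w := by
  refine ⟨?_, fun ⟨x, hx⟩ => ⟨c.mk' x, c.eq.2 hx⟩⟩
  rintro ⟨q, hq⟩
  obtain ⟨x, rfl⟩ := AddCon.mk'_surjective q
  exact ⟨x, c.eq.1 hq⟩

/-- The coefficient of `t^u` with respect to `t^w` modulo `I`, zero if `u` and `w` are not
congruent. -/
def relCoeff (I : Ideal (AddMonoidAlgebra k M)) (w u : M) : k :=
  open Classical in
  if h : inducedCon I u w then ((Classical.choose (inducedCon_iff.1 h) : kˣ) : k) else 0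

theorem relCoeff_ne_zero_iff : relCoeff I w u ≠ 0 ↔ inducedCon I u w := by
  unfold relCoeff
  split_ifs with h
  · simp [h]
  · simp [h]

theorem relCoeff_spec (h : inducedCon I u w) : mono k u - relCoeff I w u • mono k w ∈ I := by
  unfold relCoeff
  rw [dif_pos h]
  exact Classical.choose_spec (inducedCon_iff.1 h)

theorem relCoeff_eq (hw : mono k w ∉ I) (l : kˣ) (h : mono k u - (l : k) • mono k w ∈ I) :
    relCoeff I w u = l :=
  scalar_unique hw (relCoeff_spec ⟨l, h⟩) h

/-- The linear functional reading off the coefficient at the class of `w` modulo `I`. -/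
def classCoeff (I : Ideal (AddMonoidAlgebra k M)) (w : M) : AddMonoidAlgebra k M →ₗ[k] k :=
  Finsupp.linearCombination k (relCoeff I w) ∘ₗ (coeffLinearEquiv k).toLinearMap

theorem classCoeff_mono : classCoeff I w (mono k u) = relCoeff I w u := by
  simp [classCoeff, mono]

theorem classCoeff_mono_ne_zero_iff : classCoeff I w (mono k u) ≠ 0 ↔ inducedCon I u w := by
  rw [classCoeff_mono, relCoeff_ne_zero_iff]

theorem classCoeff_mono_eq_zero (h : ¬ inducedCon I u w) : classCoeff I w (mono k u) = 0 := by
  by_contra h'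
  exact h (classCoeff_mono_ne_zero_iff.1 h')

theorem classCoeff_self_ne_zero : classCoeff I w (mono k w) ≠ 0 :=
  classCoeff_mono_ne_zero_iff.2 ((inducedCon I).refl w)

/-- If `l = 0`, the monomial lies in `I`, so it is not congruent to `w`. Otherwise `p` and `q` are
congruent: either both miss the class of `w`, or uniqueness of scalars makes the two contributions
cancel. -/
theorem classCoeff_binomial (hw : mono k w ∉ I) {p q : M} {l : k}
    (h : mono k p - l • mono k q ∈ I) : classCoeff I w (mono k p - l • mono k q) = 0 := by
  rw [map_sub, map_smul, smul_eq_mul]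
  rcases eq_or_ne l 0 with rfl | hl
  · rw [zero_smul, sub_zero] at h
    rw [zero_mul, sub_zero]
    exact classCoeff_mono_eq_zero fun h' => hw ((mono_mem_iff_of_rel h').1 h)
  · have hpq : inducedCon I p q := ⟨Units.mk0 l hl, h⟩
    by_cases hq : inducedCon I q w
    · have hp := (inducedCon I).trans hpq hq
      rw [classCoeff_mono, classCoeff_mono, sub_eq_zero]
      refine scalar_unique hw (relCoeff_spec hp) ?_
      have := I.add_mem h (ksmul_mem l (relCoeff_spec hq))
      rwa [smul_sub, smul_smul, sub_add_sub_cancel] at this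
    · rw [classCoeff_mono_eq_zero hq, classCoeff_mono_eq_zero fun hp =>
        hq ((inducedCon I).trans ((inducedCon I).symm hpq) hp)]
      simp

theorem classCoeff_eq_zero (hI : IsBinomialIdeal I) (hw : mono k w ∉ I) {f : AddMonoidAlgebra k M}
    (hf : f ∈ I) : classCoeff I w f = 0 := by
  obtain ⟨S, hS, rfl⟩ := hI
  refine mem_of_mem_span (LinearMap.ker (classCoeff (Ideal.span S) w)) (fun r s hs => ?_) hf
  obtain ⟨p, q, l, rfl⟩ := hS s hs
  have := (Ideal.span S).mul_mem_left (mono k r) (Ideal.subset_span hs)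
  rw [mono_mul_binomial] at this ⊢
  exact classCoeff_binomial hw this

end Congruence

/-! ### Reduction modulo binomials -/

section Reduction

variable {k : Type*} [Field k] {M : Type*} [AddCommMonoid M]

/-- The ideal generated by the binomials in `I`. -/
def binomialPart (I : Ideal (AddMonoidAlgebra k M)) : Ideal (AddMonoidAlgebra k M) :=
  Ideal.span {f | f ∈ I ∧ ∃ (p q : M) (l : k), f = mono k p - l • mono k q}

theorem binomialPart_le (I : Ideal (AddMonoidAlgebra k M)) : binomialPart I ≤ I :=
  Ideal.span_le.2 fun _ h => h.1

theorem binomial_mem_binomialPart {I : Ideal (AddMonoidAlgebra k M)} {p q : M} {l : k}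
    (h : mono k p - l • mono k q ∈ I) : mono k p - l • mono k q ∈ binomialPart I :=
  Ideal.subset_span ⟨h, p, q, l, rfl⟩

theorem mono_mem_binomialPart {I : Ideal (AddMonoidAlgebra k M)} {p : M}
    (h : mono k p ∈ I) : mono k p ∈ binomialPart I := by
  simpa using binomial_mem_binomialPart (I := I) (p := p) (q := p) (l := (0 : k))
    (by simpa using h)

theorem isBinomialIdeal_of_le_binomialPart {I : Ideal (AddMonoidAlgebra k M)}
    (h : I ≤ binomialPart I) : IsBinomialIdeal I :=
  ⟨_, fun _ hf => hf.2, le_antisymm h (binomialPart_le I)⟩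

theorem le_of_binomials_mem {I J : Ideal (AddMonoidAlgebra k M)} (hI : IsBinomialIdeal I)
    (h : ∀ (p q : M) (l : k), mono k p - l • mono k q ∈ I → mono k p - l • mono k q ∈ J) :
    I ≤ J := by
  obtain ⟨S, hS, rfl⟩ := hI
  refine Ideal.span_le.2 fun f hf => ?_
  obtain ⟨p, q, l, rfl⟩ := hS f hf
  exact h p q l (Ideal.subset_span hf)

theorem IsBinomialIdeal.sup {I J : Ideal (AddMonoidAlgebra k M)} (hI : IsBinomialIdeal I)
    (hJ : IsBinomialIdeal J) : IsBinomialIdeal (I ⊔ J) := by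
  obtain ⟨S, hS, rfl⟩ := hI
  obtain ⟨T, hT, rfl⟩ := hJ
  exact ⟨S ∪ T, fun f hf => hf.elim (hS f) (hT f), (Ideal.span_union S T).symm⟩

theorem isBinomialIdeal_span_mono (X : Set M) :
    IsBinomialIdeal (Ideal.span ((fun u => mono k u) '' X)) := by
  refine ⟨_, ?_, rfl⟩
  rintro _ ⟨p, _, rfl⟩
  exact ⟨p, p, 0, by simp⟩

/-- `f` is in normal form modulo `I`: its monomials are not in `I` and pairwise incongruent. -/
structure IsReduced (I : Ideal (AddMonoidAlgebra k M)) (f : AddMonoidAlgebra k M) : Prop where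
  mono_notMem : ∀ u ∈ f.coeff.support, mono k u ∉ I
  eq_of_rel : ∀ u ∈ f.coeff.support, ∀ v ∈ f.coeff.support, inducedCon I u v → u = v

/-- Induction on the size of the support: drop a monomial lying in `I`, or trade a monomial for a
congruent one already present. Only binomials of `I` are used, so `I` itself need not be binomial;
this is what makes the lemma a test for being binomial. -/
theorem exists_isReduced (I : Ideal (AddMonoidAlgebra k M)) (f : AddMonoidAlgebra k M) :
    ∃ f₀, f - f₀ ∈ binomialPart I ∧ f₀.coeff.support ⊆ f.coeff.support ∧ IsReduced I f₀ := by
  induction hn : f.coeff.support.card using Nat.strong_induction_on generalizing f with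
  | _ n ih =>
  have step : ∀ g, f - g ∈ binomialPart I → g.coeff.support ⊂ f.coeff.support →
      ∃ f₀, f - f₀ ∈ binomialPart I ∧ f₀.coeff.support ⊆ f.coeff.support ∧ IsReduced I f₀ := by
    intro g hg hs
    obtain ⟨f₀, h₁, h₂, h₃⟩ := ih _ (hn ▸ Finset.card_lt_card hs) g rfl
    refine ⟨f₀, ?_, h₂.trans hs.subset, h₃⟩
    simpa using Ideal.add_mem _ hg h₁
  by_cases h₁ : ∀ u ∈ f.coeff.support, mono k u ∉ I
  swap
  · push Not at h₁
    obtain ⟨u, hu, huI⟩ := h₁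
    refine step (f.erase u) ?_ ?_
    · have : f - f.erase u = f.coeff u • mono k u := by
        rw [sub_eq_iff_eq_add, ← single_eq_smul_mono, single_add_erase]
      rw [this]
      exact ksmul_mem _ (mono_mem_binomialPart huI)
    · classical
      rw [coeff_erase, Finsupp.support_erase]
      exact Finset.erase_ssubset hu
  by_cases h₂ : ∀ u ∈ f.coeff.support, ∀ v ∈ f.coeff.support, inducedCon I u v → u = v
  · exact ⟨f, by simp, subset_rfl, h₁, h₂⟩
  push Not at h₂
  obtain ⟨u, hu, v, hv, ⟨l, hl⟩, huv⟩ := h₂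
  -- This cancels the term at `u` and otherwise changes only the coefficient at `v`, which is
  -- already in the support.
  refine step (f - f.coeff u • (mono k u - (l : k) • mono k v)) ?_ ?_
  · rw [sub_sub_cancel]
    exact ksmul_mem _ (binomial_mem_binomialPart hl)
  · rw [Finset.ssubset_iff_of_subset]
    · refine ⟨u, hu, ?_⟩
      simp [mono, Ne.symm huv]
    · intro x hx
      by_contra hxf
      have hxu : u ≠ x := fun h => hxf (h ▸ hu)
      have hxv : v ≠ x := fun h => hxf (h ▸ hv)
      rw [Finsupp.mem_support_iff] at hx
      apply hx
      simp [mono, hxu, hxv, Finsupp.notMem_support_iff.1 hxf]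

theorem mapDomainRingHom_mono {Q : Type*} [AddCommMonoid Q] (φ : Q →+ M) (u : Q) :
    mapDomainRingHom k φ (mono k u) = mono k (φ u) := by
  simp [mono]

theorem mapDomainRingHom_smul {Q : Type*} [AddCommMonoid Q] (φ : Q →+ M) (a : k)
    (f : AddMonoidAlgebra k Q) : mapDomainRingHom k φ (a • f) = a • mapDomainRingHom k φ f :=
  (mapDomainLinearMap k k (φ : Q → M)).map_smul a f

theorem mapDomainRingHom_binomial {Q : Type*} [AddCommMonoid Q] (φ : Q →+ M) (p q : Q) (l : k) :
    mapDomainRingHom k φ (mono k p - l • mono k q) = mono k (φ p) - l • mono k (φ q) := by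
  rw [map_sub, mapDomainRingHom_smul, mapDomainRingHom_mono, mapDomainRingHom_mono]

/-- Reduce an element of the preimage modulo the binomials of the preimage. Incongruent monomials
have incongruent images, so a nonzero remainder would be detected by a class functional of `I`. -/
theorem IsBinomialIdeal.comap {Q : Type*} [AddCommMonoid Q] (φ : Q →+ M)
    {I : Ideal (AddMonoidAlgebra k M)} (hI : IsBinomialIdeal I) :
    IsBinomialIdeal (I.comap (mapDomainRingHom k φ)) := by
  refine isBinomialIdeal_of_le_binomialPart fun f hf => ?_
  obtain ⟨f₀, h₁, -, h₂⟩ := exists_isReduced (I.comap (mapDomainRingHom k φ)) f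
  have hf₀ : f₀ ∈ I.comap (mapDomainRingHom k φ) := by
    have := Ideal.sub_mem _ hf (binomialPart_le _ h₁)
    rwa [sub_sub_cancel] at this
  rcases eq_or_ne f₀ 0 with rfl | hne
  · simpa using h₁
  exfalso
  obtain ⟨u, hu⟩ := Finsupp.support_nonempty_iff.2 (fun h => hne (coeff_eq_zero.1 h))
  have hu' : mono k (φ u) ∉ I := by
    have := h₂.mono_notMem u hu
    rwa [Ideal.mem_comap, mapDomainRingHom_mono] at this
  let T : AddMonoidAlgebra k Q →ₗ[k] k := classCoeff I (φ u) ∘ₗ mapDomainLinearMap k k (φ : Q → M)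
  have hT : ∀ v, T (mono k v) = classCoeff I (φ u) (mono k (φ v)) := fun v => by
    simp [T, mono]
  have h0 : T f₀ = 0 := classCoeff_eq_zero hI hu' hf₀
  rw [linearMap_apply_of_isolated T (u := u), hT] at h0
  · exact mul_ne_zero (Finsupp.mem_support_iff.1 hu) classCoeff_self_ne_zero h0
  · intro v hv hvu
    rw [hT]
    refine classCoeff_mono_eq_zero fun h => hvu (h₂.eq_of_rel v hv u hu ?_)
    obtain ⟨l, hl⟩ := h
    exact ⟨l, by rwa [Ideal.mem_comap, mapDomainRingHom_binomial]⟩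

theorem IsBinomialIdeal.map {Q : Type*} [AddCommMonoid Q] (φ : Q →+ M)
    {I : Ideal (AddMonoidAlgebra k Q)} (hI : IsBinomialIdeal I) :
    IsBinomialIdeal (I.map (mapDomainRingHom k φ)) := by
  obtain ⟨S, hS, rfl⟩ := hI
  refine ⟨mapDomainRingHom k φ '' S, ?_, Ideal.map_span _ _⟩
  rintro _ ⟨f, hf, rfl⟩
  obtain ⟨p, q, l, rfl⟩ := hS f hf
  exact ⟨φ p, φ q, l, mapDomainRingHom_binomial φ p q l⟩

end Reduction

/-! ### Monomial localization -/

section Localization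

variable {k : Type*} [Field k] {Q : Type*} [AddCommMonoid Q] {P : Set Q} (hP : IsPrimeIdeal P)

theorem isAddUnit_toLoc {s : Q} (hs : s ∉ P) : IsAddUnit (toLoc hP s) :=
  (AddLocalization.addMonoidOf hP.compl).map_addUnits ⟨s, hs⟩

theorem exists_toLoc_add_eq (x : Loc hP) :
    ∃ q s : Q, s ∉ P ∧ toLoc hP s + x = toLoc hP q := by
  obtain ⟨⟨q, s⟩, h⟩ := (AddLocalization.addMonoidOf hP.compl).surj x
  exact ⟨q, s, s.2, by rw [add_comm]; exact h⟩

theorem toLoc_eq_iff {a b : Q} : toLoc hP a = toLoc hP b ↔ ∃ c ∉ P, c + a = c + b := by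
  refine ((AddLocalization.addMonoidOf hP.compl).eq_iff_exists).trans ?_
  exact ⟨fun ⟨c, h⟩ => ⟨c, c.2, h⟩, fun ⟨c, hc, h⟩ => ⟨⟨c, hc⟩, h⟩⟩

theorem add_notMem_prime (hP : IsPrimeIdeal P) {a b : Q} (ha : a ∉ P) (hb : b ∉ P) :
    a + b ∉ P :=
  hP.compl.add_mem ha hb

theorem isAddUnit_toLoc_iff {q : Q} : IsAddUnit (toLoc hP q) ↔ q ∉ P := by
  refine ⟨fun h hq => ?_, isAddUnit_toLoc hP⟩
  obtain ⟨y, hy⟩ := isAddUnit_iff_exists_neg.1 h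
  obtain ⟨r, s, hs, hrs⟩ := exists_toLoc_add_eq hP y
  have h1 : toLoc hP (q + r) = toLoc hP s := by
    rw [map_add, ← hrs, add_left_comm, hy, add_zero]
  obtain ⟨c, hc, h2⟩ := (toLoc_eq_iff hP).1 h1
  refine add_notMem_prime hP hc hs (h2 ▸ ?_)
  rw [add_comm q r]
  exact hP.add_mem _ _ (hP.add_mem _ _ hq)

theorem locMap_mono (u : Q) : locMap hP k (mono k u) = mono k (toLoc hP u) :=
  mapDomainRingHom_mono _ u

theorem locMap_smul (a : k) (f : AddMonoidAlgebra k Q) :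
    locMap hP k (a • f) = a • locMap hP k f :=
  mapDomainRingHom_smul _ a f

theorem locMap_binomial (p q : Q) (l : k) :
    locMap hP k (mono k p - l • mono k q) = mono k (toLoc hP p) - l • mono k (toLoc hP q) :=
  mapDomainRingHom_binomial _ p q l

theorem exists_mul_eq_locMap (F : AddMonoidAlgebra k (Loc hP)) :
    ∃ s ∉ P, ∃ f : AddMonoidAlgebra k Q, mono k (toLoc hP s) * F = locMap hP k f := by
  induction F using AddMonoidAlgebra.induction_linear with
  | zero => exact ⟨0, hP.zero_notMem, 0, by simp⟩
  | add F G hF hG =>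
    obtain ⟨s, hs, f, hf⟩ := hF
    obtain ⟨t, ht, g, hg⟩ := hG
    refine ⟨s + t, add_notMem_prime hP hs ht, mono k t * f + mono k s * g, ?_⟩
    rw [map_add, map_add, map_mul, map_mul, ← hf, ← hg, mono_add, locMap_mono, locMap_mono]
    ring
  | single x a =>
    obtain ⟨q, s, hs, h⟩ := exists_toLoc_add_eq hP x
    refine ⟨s, hs, a • mono k q, ?_⟩
    rw [single_eq_smul_mono, mul_smul_comm, ← mono_add, h, locMap_smul, locMap_mono]

/-- The elements of `k[Q]` that some monomial `t^s` with `s ∉ P` multiplies into `I`. -/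
def saturation (I : Ideal (AddMonoidAlgebra k Q)) : Ideal (AddMonoidAlgebra k Q) where
  carrier := {f | ∃ s ∉ P, mono k s * f ∈ I}
  zero_mem' := ⟨0, hP.zero_notMem, by simp⟩
  add_mem' := by
    rintro f g ⟨s, hs, hf⟩ ⟨t, ht, hg⟩
    refine ⟨s + t, add_notMem_prime hP hs ht, ?_⟩
    have : mono k (s + t) * (f + g) = mono k t * (mono k s * f) + mono k s * (mono k t * g) := by
      rw [mono_add]; ring
    rw [this]
    exact I.add_mem (I.mul_mem_left _ hf) (I.mul_mem_left _ hg)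
  smul_mem' := by
    rintro c f ⟨s, hs, hf⟩
    exact ⟨s, hs, by rw [smul_eq_mul, mul_left_comm]; exact I.mul_mem_left _ hf⟩

/-- After reduction modulo the saturation of the zero ideal, distinct monomials have distinct images
in `Q_P`, so an element with zero image reduces to zero. -/
theorem exists_mul_eq_zero_of_locMap_eq_zero {f : AddMonoidAlgebra k Q} (hf : locMap hP k f = 0) :
    ∃ s ∉ P, mono k s * f = 0 := by
  obtain ⟨f₀, h₁, -, h₂⟩ := exists_isReduced (saturation hP (⊥ : Ideal (AddMonoidAlgebra k Q))) f
  obtain ⟨s, hs, h⟩ := binomialPart_le _ h₁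
  rcases eq_or_ne f₀ 0 with rfl | hne
  · exact ⟨s, hs, by simpa using h⟩
  exfalso
  obtain ⟨u, hu⟩ := Finsupp.support_nonempty_iff.2 (fun h => hne (coeff_eq_zero.1 h))
  have hf₀ : locMap hP k f₀ = 0 := by
    have h' := congrArg (locMap hP k) (Ideal.mem_bot.1 h)
    rw [map_mul, map_sub, hf, map_zero, zero_sub, locMap_mono] at h'
    have := (mono_mul_mem_iff (I := ⊥) (isAddUnit_toLoc hP hs)).1 (Ideal.mem_bot.2 h')
    simpa using this
  let T : AddMonoidAlgebra k Q →ₗ[k] k :=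
    Finsupp.lapply (toLoc hP u) ∘ₗ (coeffLinearEquiv k).toLinearMap ∘ₗ
      mapDomainLinearMap k k (toLoc hP : Q → Loc hP)
  have hT : ∀ v, T (mono k v) = Finsupp.single (toLoc hP v) (1 : k) (toLoc hP u) := fun v => by
    simp [T, mono]
  have h0 : T f₀ = 0 := by
    have : T f₀ = (locMap hP k f₀).coeff (toLoc hP u) := rfl
    rw [this, hf₀]; simp
  rw [linearMap_apply_of_isolated T (u := u), hT] at h0
  · simp only [Finsupp.single_eq_same, smul_eq_mul, mul_one] at h0
    exact Finsupp.mem_support_iff.1 hu h0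
  · intro v hv hvu
    classical
    rw [hT, Finsupp.single_apply, if_neg]
    intro hvu'
    refine hvu (h₂.eq_of_rel v hv u hu ⟨1, ?_⟩)
    obtain ⟨c, hc, hcc⟩ := (toLoc_eq_iff hP).1 hvu'
    exact ⟨c, hc, by simp [mul_sub, ← mono_add, hcc]⟩

theorem locMap_mem_locIdeal {I : Ideal (AddMonoidAlgebra k Q)} {f : AddMonoidAlgebra k Q}
    (hf : f ∈ I) : locMap hP k f ∈ locIdeal hP I :=
  Ideal.mem_map_of_mem _ hf

/-- Clearing denominators gives an equality of images in `k[Q]_P`;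
`exists_mul_eq_zero_of_locMap_eq_zero` lifts it to `k[Q]` after one more monomial factor. -/
theorem locMap_mem_locIdeal_iff {I : Ideal (AddMonoidAlgebra k Q)} {f : AddMonoidAlgebra k Q} :
    locMap hP k f ∈ locIdeal hP I ↔ ∃ s ∉ P, mono k s * f ∈ I := by
  constructor
  · intro hf
    have key : ∀ F ∈ locIdeal hP I, ∃ s ∉ P, ∃ g ∈ I,
        mono k (toLoc hP s) * F = locMap hP k g := by
      intro F hF
      induction hF using Submodule.span_induction with
      | mem x hx =>
        obtain ⟨g, hg, rfl⟩ := hx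
        exact ⟨0, hP.zero_notMem, g, hg, by simp [mono_zero]⟩
      | zero => exact ⟨0, hP.zero_notMem, 0, I.zero_mem, by simp⟩
      | add F G _ _ hF hG =>
        obtain ⟨s, hs, f, hfI, hf⟩ := hF
        obtain ⟨t, ht, g, hgI, hg⟩ := hG
        refine ⟨s + t, add_notMem_prime hP hs ht, mono k t * f + mono k s * g,
          I.add_mem (I.mul_mem_left _ hfI) (I.mul_mem_left _ hgI), ?_⟩
        rw [map_add, map_add, map_mul, map_mul, ← hf, ← hg, mono_add, locMap_mono, locMap_mono]
        ring
      | smul a x _ hx =>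
        obtain ⟨s, hs, f, hfI, hf⟩ := hx
        obtain ⟨t, ht, g, hg⟩ := exists_mul_eq_locMap hP a
        refine ⟨s + t, add_notMem_prime hP hs ht, g * f, I.mul_mem_left _ hfI, ?_⟩
        rw [map_mul, ← hf, ← hg, map_add, mono_add, smul_eq_mul]
        ring
    obtain ⟨s, hs, g, hg, h⟩ := key _ hf
    have h0 : locMap hP k (mono k s * f - g) = 0 := by
      rw [map_sub, map_mul, locMap_mono, h, sub_self]
    obtain ⟨t, ht, h1⟩ := exists_mul_eq_zero_of_locMap_eq_zero hP h0
    refine ⟨t + s, add_notMem_prime hP ht hs, ?_⟩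
    rw [mul_sub, sub_eq_zero] at h1
    rw [mono_add, mul_assoc, h1]
    exact I.mul_mem_left _ hg
  · rintro ⟨s, hs, h⟩
    have := locMap_mem_locIdeal hP h
    rw [map_mul, locMap_mono] at this
    exact (mono_mul_mem_iff (isAddUnit_toLoc hP hs)).1 this

theorem locIdeal_comap (J : Ideal (AddMonoidAlgebra k (Loc hP))) :
    locIdeal hP (J.comap (locMap hP k)) = J := by
  refine le_antisymm Ideal.map_comap_le fun F hF => ?_
  obtain ⟨s, hs, f, hf⟩ := exists_mul_eq_locMap hP F
  rw [← mono_mul_mem_iff (isAddUnit_toLoc hP hs), hf]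
  refine locMap_mem_locIdeal hP ?_
  rw [Ideal.mem_comap, ← hf]
  exact J.mul_mem_left _ hF

theorem comap_locMap_injective :
    Function.Injective (Ideal.comap (locMap hP k) : Ideal (AddMonoidAlgebra k (Loc hP)) → _) :=
  fun J J' h => by rw [← locIdeal_comap hP J, ← locIdeal_comap hP J']; exact congrArg _ h

theorem IsBinomialIdeal.locIdeal {I : Ideal (AddMonoidAlgebra k Q)} (hI : IsBinomialIdeal I) :
    IsBinomialIdeal (locIdeal hP I) :=
  hI.map (toLoc hP)

theorem maxMono_eq :
    maxMono hP k = Ideal.span ((fun x => mono k x) '' {x : Loc hP | ¬ IsAddUnit x}) := by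
  refine le_antisymm (Ideal.span_mono ?_) (Ideal.span_le.2 ?_)
  · rintro _ ⟨p, hp, rfl⟩
    exact ⟨toLoc hP p, fun h => (isAddUnit_toLoc_iff hP).1 h hp, rfl⟩
  · rintro _ ⟨x, hx, rfl⟩
    obtain ⟨q, s, hs, h⟩ := exists_toLoc_add_eq hP x
    change mono k x ∈ maxMono hP k
    rw [← mono_add_mem_iff (isAddUnit_toLoc hP hs), h]
    refine Ideal.subset_span ⟨q, ?_, rfl⟩
    by_contra hq
    refine hx ((IsAddUnit.add_iff (x := toLoc hP s)).1 ?_).2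
    rw [h]
    exact isAddUnit_toLoc hP hq

theorem mono_mem_maxMono {x : Loc hP} (hx : ¬ IsAddUnit x) : mono k x ∈ maxMono hP k := by
  rw [maxMono_eq]
  exact Ideal.subset_span ⟨x, hx, rfl⟩

theorem locClass_eq_iff {I : Ideal (AddMonoidAlgebra k Q)} {x : Loc hP} {q : Q} :
    (inducedCon (locIdeal hP I)).mk' x = locClass hP I q ↔
      inducedCon (locIdeal hP I) x (toLoc hP q) :=
  (inducedCon (locIdeal hP I)).eq

end Localization

/-! ### The largest ideal on which a class coefficient vanishes -/

section ClassKernel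

variable {k : Type*} [Field k] {M : Type*} [AddCommMonoid M]

/-- The largest ideal in the kernel of the functional `classCoeff I w`. -/
def classKernel (I : Ideal (AddMonoidAlgebra k M)) (w : M) : Ideal (AddMonoidAlgebra k M) where
  carrier := {f | ∀ v : M, classCoeff I w (mono k v * f) = 0}
  zero_mem' := by simp
  add_mem' := fun hf hg v => by rw [mul_add, map_add, hf v, hg v, add_zero]
  smul_mem' := by
    intro c f hf v
    induction c using AddMonoidAlgebra.induction_linear with
    | zero => simp
    | add a b ha hb => rw [add_smul, mul_add, map_add, ha, hb, add_zero]
    | single u a =>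
      rw [single_eq_smul_mono, smul_assoc, mul_smul_comm, map_smul, smul_eq_mul (mono k u),
        ← mul_assoc, ← mono_add, hf, smul_zero]

variable {I : Ideal (AddMonoidAlgebra k M)} {w : M}

theorem le_classKernel (hI : IsBinomialIdeal I) (hw : mono k w ∉ I) : I ≤ classKernel I w :=
  fun _ hf _ => classCoeff_eq_zero hI hw (I.mul_mem_left _ hf)

theorem mono_mem_classKernel_iff {u : M} :
    mono k u ∈ classKernel I w ↔ ∀ x : M, ¬ inducedCon I (x + u) w := by
  refine forall_congr' fun x => ?_
  rw [← mono_add, ← classCoeff_mono_ne_zero_iff, not_not]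

/-- A unit stabilizing the class of `w` multiplies the coefficients at that class by a scalar. -/
theorem classCoeff_add_of_stabilizes (hw : mono k w ∉ I) {g : M} (hg : IsAddUnit g) {l : kˣ}
    (h : mono k (g + w) - (l : k) • mono k w ∈ I) (y : M) :
    classCoeff I w (mono k (g + y)) = l * classCoeff I w (mono k y) := by
  by_cases hy : inducedCon I y w
  · obtain ⟨a, ha⟩ := hy
    rw [classCoeff_mono, classCoeff_mono, relCoeff_eq hw a ha, ← Units.val_mul]
    refine relCoeff_eq hw _ ?_
    have h1 := I.mul_mem_left (mono k g) ha
    rw [mono_mul_binomial] at h1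
    have h2 := I.add_mem h1 (ksmul_mem (a : k) h)
    rwa [smul_sub, smul_smul, sub_add_sub_cancel, ← Units.val_mul, mul_comm] at h2
  · rw [classCoeff_mono_eq_zero hy, mul_zero]
    refine classCoeff_mono_eq_zero fun h' => hy (rel_of_isAddUnit_add hg ?_)
    exact (inducedCon I).trans h' ((inducedCon I).symm ⟨l, h⟩)

end ClassKernel

/-! ### Characters -/

section Character

variable {k : Type*} [Field k] {Q : Type*} [AddCommMonoid Q] {P : Set Q} (hP : IsPrimeIdeal P)
  {K : AddSubgroup (AddUnits (Loc hP))} (ρ : Multiplicative K →* kˣ)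

open Classical in
/-- The value of `ρ` on the units in `K`, extended by zero. -/
def charValue (x : Loc hP) : k :=
  if h : ∃ g : K, ((g : AddUnits (Loc hP)) : Loc hP) = x then
    (ρ (Multiplicative.ofAdd h.choose) : k) else 0

theorem charValue_of_mem {g : AddUnits (Loc hP)} (hg : g ∈ K) :
    charValue hP ρ (g : Loc hP) = ρ (Multiplicative.ofAdd ⟨g, hg⟩) := by
  have h : ∃ g' : K, ((g' : AddUnits (Loc hP)) : Loc hP) = g := ⟨⟨g, hg⟩, rfl⟩
  have h' : h.choose = ⟨g, hg⟩ := Subtype.ext (AddUnits.ext h.choose_spec)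
  rw [charValue, dif_pos h, h']

theorem charValue_of_notMem {g : AddUnits (Loc hP)} (hg : g ∉ K) :
    charValue hP ρ (g : Loc hP) = 0 := by
  rw [charValue, dif_neg]
  rintro ⟨g', h⟩
  exact hg (AddUnits.ext h ▸ g'.2)

theorem charValue_of_not_isAddUnit {x : Loc hP} (hx : ¬ IsAddUnit x) : charValue hP ρ x = 0 := by
  rw [charValue, dif_neg]
  rintro ⟨g, rfl⟩
  exact hx g.1.isAddUnit

/-- The linear functional on `k[Q]_P` with values `charValue`. -/
def charFunctional : AddMonoidAlgebra k (Loc hP) →ₗ[k] k :=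
  Finsupp.linearCombination k (charValue hP ρ) ∘ₗ (coeffLinearEquiv k).toLinearMap

theorem charFunctional_mono (x : Loc hP) :
    charFunctional hP ρ (mono k x) = charValue hP ρ x := by
  simp [charFunctional, mono]

/-- This functional shows that `I_ρ + m_P` is proper and that both `K` and `ρ` can be recovered from
it. -/
theorem charFunctional_eq_zero {f : AddMonoidAlgebra k (Loc hP)}
    (hf : f ∈ charIdeal hP ρ ⊔ maxMono hP k) : charFunctional hP ρ f = 0 := by
  rw [charIdeal, maxMono_eq, ← Ideal.span_union] at hf
  refine mem_of_mem_span (LinearMap.ker (charFunctional hP ρ)) (fun r s hs => ?_) hf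
  rw [LinearMap.mem_ker]
  rcases hs with ⟨u, v, h, rfl⟩ | ⟨x, hx, rfl⟩
  · rw [mono_mul_binomial, map_sub, map_smul, charFunctional_mono, charFunctional_mono, sub_eq_zero,
      smul_eq_mul]
    by_cases hr : IsAddUnit r
    · obtain ⟨r, rfl⟩ := hr
      rw [← AddUnits.val_add, ← AddUnits.val_add]
      by_cases hv : r + v ∈ K
      · have hu : r + u ∈ K := by
          have := K.add_mem h hv
          rwa [show u - v + (r + v) = r + u by abel] at this
        rw [charValue_of_mem hP ρ hu, charValue_of_mem hP ρ hv, ← Units.val_mul, ← map_mul,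
          ← ofAdd_add]
        congr 4
        change r + u = u - v + (r + v)
        abel
      · have hu : r + u ∉ K := fun hu => hv (by
          have := K.sub_mem hu h
          rwa [add_sub_assoc, sub_sub_cancel] at this)
        rw [charValue_of_notMem hP ρ hu, charValue_of_notMem hP ρ hv, mul_zero]
    · have hn : ∀ y : Loc hP, charValue hP ρ (r + y) = 0 := fun y =>
        charValue_of_not_isAddUnit hP ρ fun hy => hr (IsAddUnit.add_iff.1 hy).1
      rw [hn, hn, mul_zero]
  · simp only
    rw [← mono_add, charFunctional_mono]
    exact charValue_of_not_isAddUnit hP ρ fun hy => hx (IsAddUnit.add_iff.1 hy).2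

theorem one_notMem_charIdeal_sup_maxMono :
    (1 : AddMonoidAlgebra k (Loc hP)) ∉ charIdeal hP ρ ⊔ maxMono hP k := by
  intro h
  have := charFunctional_eq_zero hP ρ h
  rw [← mono_zero, charFunctional_mono, ← AddUnits.val_zero, charValue_of_mem hP ρ K.zero_mem]
    at this
  exact Units.ne_zero _ this

theorem mem_of_binomial_mem_charIdeal_sup_maxMono {g : AddUnits (Loc hP)} {l : k} (hl : l ≠ 0)
    (h : mono k (g : Loc hP) - l • 1 ∈ charIdeal hP ρ ⊔ maxMono hP k) :
    ∃ hg : g ∈ K, (ρ (Multiplicative.ofAdd ⟨g, hg⟩) : k) = l := by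
  have h1 := charFunctional_eq_zero hP ρ h
  have h0 : charFunctional hP ρ 1 = 1 := by
    rw [← mono_zero, charFunctional_mono, ← AddUnits.val_zero, charValue_of_mem hP ρ K.zero_mem]
    have : (⟨0, K.zero_mem⟩ : K) = 0 := rfl
    rw [this]
    simp
  rw [map_sub, map_smul, h0, charFunctional_mono, smul_eq_mul, mul_one, sub_eq_zero] at h1
  by_cases hg : g ∈ K
  · exact ⟨hg, by rw [← h1, charValue_of_mem hP ρ hg]⟩
  · exact absurd ((charValue_of_notMem hP ρ hg).symm.trans h1).symm hl

theorem binomial_mem_charIdeal {g : AddUnits (Loc hP)} (hg : g ∈ K) :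
    mono k (g : Loc hP) - (ρ (Multiplicative.ofAdd ⟨g, hg⟩) : k) • (1 : AddMonoidAlgebra k (Loc hP))
      ∈ charIdeal hP ρ := by
  refine Ideal.subset_span ⟨g, 0, by simpa using hg, ?_⟩
  simp [mono_zero]

theorem binomial_add_mem_charIdeal {g : AddUnits (Loc hP)} (hg : g ∈ K) (x : Loc hP) :
    mono k (g + x) - (ρ (Multiplicative.ofAdd ⟨g, hg⟩) : k) • mono k x ∈ charIdeal hP ρ := by
  have := Ideal.mul_mem_left _ (mono k x) (binomial_mem_charIdeal hP ρ hg)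
  rwa [← mono_zero, mono_mul_binomial, add_zero, add_comm] at this

/-- The ideal of `ρ` is generated by the binomials `t^g - ρ(g)`. -/
theorem charIdeal_le {J : Ideal (AddMonoidAlgebra k (Loc hP))}
    (h : ∀ (g : AddUnits (Loc hP)) (hg : g ∈ K) (x : Loc hP),
      mono k (g + x) - (ρ (Multiplicative.ofAdd ⟨g, hg⟩) : k) • mono k x ∈ J) :
    charIdeal hP ρ ≤ J := by
  refine Ideal.span_le.2 ?_
  rintro _ ⟨u, v, huv, rfl⟩
  have := h _ huv v
  rwa [← AddUnits.val_add, sub_add_cancel] at this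

theorem isBinomialIdeal_charIdeal : IsBinomialIdeal (charIdeal hP ρ) :=
  ⟨_, by rintro _ ⟨u, v, h, rfl⟩; exact ⟨u, v, _, rfl⟩, rfl⟩

variable (I : Ideal (AddMonoidAlgebra k Q))

/-- `ρ` is the character of `I_P` at the element `w` of `Q_P`, whose class is not fixed by any
nonunit. -/
structure HasChar (w : Loc hP) : Prop where
  mono_notMem : mono k w ∉ locIdeal hP I
  mem_iff : ∀ g : AddUnits (Loc hP), g ∈ K ↔ inducedCon (locIdeal hP I) (g + w) w
  scalar : ∀ (g : AddUnits (Loc hP)) (hg : g ∈ K),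
    mono k (g + w) - (ρ (Multiplicative.ofAdd ⟨g, hg⟩) : k) • mono k w ∈ locIdeal hP I
  not_rel : ∀ x : Loc hP, ¬ IsAddUnit x → ¬ inducedCon (locIdeal hP I) (x + w) w

variable {hP ρ I} {w : Loc hP}

theorem HasChar.charIdeal_le_classKernel (h : HasChar hP ρ I w) :
    charIdeal hP ρ ≤ classKernel (locIdeal hP I) w := by
  refine charIdeal_le hP ρ fun g hg x v => ?_
  rw [mono_mul_binomial, map_sub, map_smul, add_left_comm,
    classCoeff_add_of_stabilizes h.mono_notMem g.isAddUnit (h.scalar g hg), smul_eq_mul, sub_self]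

theorem HasChar.mul_mono_mem_classKernel (h : HasChar hP ρ I w) {f : AddMonoidAlgebra k (Loc hP)}
    (hf : f ∈ charIdeal hP ρ ⊔ maxMono hP k) :
    f * mono k w ∈ classKernel (locIdeal hP I) w := by
  suffices charIdeal hP ρ ⊔ maxMono hP k ≤ (classKernel (locIdeal hP I) w).colon {mono k w} from
    Submodule.mem_colon_singleton.1 (this hf)
  refine sup_le (fun f hf => Submodule.mem_colon_singleton.2 ?_) ?_
  · exact Ideal.mul_mem_right _ _ (h.charIdeal_le_classKernel hf)
  · rw [maxMono_eq]
    refine Ideal.span_le.2 ?_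
    rintro _ ⟨x, hx, rfl⟩
    refine Submodule.mem_colon_singleton.2 ?_
    rw [smul_eq_mul, ← mono_add, mono_mem_classKernel_iff]
    intro y hy
    rw [← add_assoc] at hy
    exact h.not_rel _ (fun hyx => hx (IsAddUnit.add_iff.1 hyx).2) hy

/-- Modulo the kernel ideal at `w`, the annihilator of `t^w` is the localized mesoprime of `ρ`. -/
theorem HasChar.mem_of_mul_mono_mem_classKernel (h : HasChar hP ρ I w)
    {f : AddMonoidAlgebra k (Loc hP)} (hf : f * mono k w ∈ classKernel (locIdeal hP I) w) :
    f ∈ charIdeal hP ρ ⊔ maxMono hP k := by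
  obtain ⟨f₀, h₁, -, h₂⟩ := exists_isReduced (charIdeal hP ρ ⊔ maxMono hP k) f
  replace h₁ := binomialPart_le _ h₁
  have hf₀ : f₀ * mono k w ∈ classKernel (locIdeal hP I) w := by
    have := Ideal.sub_mem _ hf (h.mul_mono_mem_classKernel h₁)
    rwa [← sub_mul, sub_sub_cancel] at this
  rcases eq_or_ne f₀ 0 with rfl | hne
  · simpa using h₁
  exfalso
  have hunit : ∀ u ∈ f₀.coeff.support, IsAddUnit u := fun u hu => by
    by_contra hu'
    exact h₂.mono_notMem u hu (Ideal.mem_sup_right (mono_mem_maxMono hP hu'))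
  obtain ⟨u, hu⟩ := Finsupp.support_nonempty_iff.2 (fun h => hne (coeff_eq_zero.1 h))
  obtain ⟨g, rfl⟩ := hunit u hu
  -- The shift by `-g` carries the term of `f₀ * t^w` at `g + w` to the class of `w`, where the
  -- functional reads it.
  let T : AddMonoidAlgebra k (Loc hP) →ₗ[k] k := classCoeff (locIdeal hP I) w ∘ₗ
    LinearMap.mulLeft k (mono k ((-g : AddUnits (Loc hP)) : Loc hP)) ∘ₗ
      LinearMap.mulRight k (mono k w)
  have hT : ∀ v, T (mono k v) =
      classCoeff (locIdeal hP I) w (mono k (((-g : AddUnits (Loc hP)) : Loc hP) + v + w)) :=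
    fun v => by simp [T, mono_add, mul_assoc]
  have h0 : T f₀ = 0 := hf₀ _
  rw [linearMap_apply_of_isolated T (u := (g : Loc hP)), hT, AddUnits.neg_add, zero_add] at h0
  · exact mul_ne_zero (Finsupp.mem_support_iff.1 hu) classCoeff_self_ne_zero h0
  · intro v hv hvu
    obtain ⟨g', rfl⟩ := hunit v hv
    rw [hT, ← AddUnits.val_add]
    refine classCoeff_mono_eq_zero fun hr => hvu (h₂.eq_of_rel _ hv _ hu ?_)
    have hK := (h.mem_iff _).2 hr
    have := binomial_add_mem_charIdeal hP ρ hK (g : Loc hP)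
    rw [← AddUnits.val_add, show -g + g' + g = g' by abel] at this
    exact ⟨_, Ideal.mem_sup_left this⟩

theorem HasChar.binomial_mem (h : HasChar hP ρ I w) : charIdeal hP ρ ≤
    (locIdeal hP I).colon {mono k w} := by
  refine charIdeal_le hP ρ fun g hg x => Submodule.mem_colon_singleton.2 ?_
  have := Ideal.mul_mem_left _ (mono k x) (h.scalar g hg)
  rw [mono_mul_binomial] at this
  rw [smul_eq_mul, sub_mul, smul_mul_assoc, ← mono_add, ← mono_add]
  convert this using 3
  abel

theorem HasChar.colon_sup_eq (hI : IsBinomialIdeal I) (h : HasChar hP ρ I w) :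
    (locIdeal hP I).colon {mono k w} ⊔ maxMono hP k = charIdeal hP ρ ⊔ maxMono hP k := by
  refine le_antisymm (sup_le (fun f hf => ?_) le_sup_right) (sup_le_sup_right h.binomial_mem _)
  refine h.mem_of_mul_mono_mem_classKernel ?_
  exact le_classKernel (hI.locIdeal hP) h.mono_notMem (Submodule.mem_colon_singleton.1 hf)

theorem mem_stab_iff {q : Q} {g : AddUnits (Loc hP)} :
    g ∈ stab hP I q ↔ inducedCon (locIdeal hP I) (g + toLoc hP q) (toLoc hP q) :=
  locClass_eq_iff hP

/-- The clause about nonunits is forced by properness: if a nonunit `x` fixed the class of `q`, then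
`t^x - l` and `t^x` would both lie in `I_ρ + m_P`, hence so would the unit `l`. -/
theorem isCharAt_iff (hI : IsBinomialIdeal I) {q : Q}
    (hq : mono k (toLoc hP q) ∉ locIdeal hP I) :
    IsCharAt hP I q ρ ↔ HasChar hP ρ I (toLoc hP q) := by
  constructor
  · rintro ⟨hK, hρ⟩
    have key : ∀ (x : Loc hP) (l : k),
        mono k (x + toLoc hP q) - l • mono k (toLoc hP q) ∈ locIdeal hP I →
        mono k x - l • 1 ∈ charIdeal hP ρ ⊔ maxMono hP k := by
      intro x l h
      rw [hρ]
      refine Ideal.mem_sup_left (Submodule.mem_colon_singleton.2 ?_)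
      rwa [smul_eq_mul, sub_mul, smul_mul_assoc, one_mul, ← mono_add]
    have hmem : ∀ g : AddUnits (Loc hP), g ∈ K ↔
        inducedCon (locIdeal hP I) (g + toLoc hP q) (toLoc hP q) := fun g => by
      rw [hK]; exact mem_stab_iff
    refine ⟨hq, hmem, fun g hg => ?_, fun x hx => ?_⟩
    · obtain ⟨l, hl⟩ := (hmem g).1 hg
      obtain ⟨_, h⟩ := mem_of_binomial_mem_charIdeal_sup_maxMono hP ρ l.ne_zero (key _ _ hl)
      rwa [h]
    · rintro ⟨l, hl⟩
      have h1 := Ideal.sub_mem _ (Ideal.mem_sup_right (mono_mem_maxMono hP hx)) (key _ _ hl)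
      rw [sub_sub_cancel] at h1
      exact one_notMem_charIdeal_sup_maxMono hP ρ (mem_of_ksmul_mem l.ne_zero h1)
  · intro h
    refine ⟨?_, (h.colon_sup_eq hI).symm⟩
    ext g
    rw [h.mem_iff, mem_stab_iff]

/-- The scalar by which a stabilizing unit acts on `t^w` is unique because `t^w ∉ I_P`, and
uniqueness makes it multiplicative. -/
theorem exists_hasChar (hw : mono k w ∉ locIdeal hP I)
    (h : ∀ x : Loc hP, ¬ IsAddUnit x → ¬ inducedCon (locIdeal hP I) (x + w) w) :
    ∃ (K : AddSubgroup (AddUnits (Loc hP))) (ρ : Multiplicative K →* kˣ), HasChar hP ρ I w := by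
  let K : AddSubgroup (AddUnits (Loc hP)) :=
    { carrier := {g | inducedCon (locIdeal hP I) (g + w) w}
      zero_mem' := by simpa using (inducedCon (locIdeal hP I)).refl w
      add_mem' := fun {a b} ha hb => by
        have := (inducedCon (locIdeal hP I)).trans (rel_add_left (a : Loc hP) hb) ha
        rwa [← add_assoc] at this
      neg_mem' := fun {a} ha => by
        refine rel_of_isAddUnit_add a.isAddUnit ?_
        rw [← add_assoc, AddUnits.add_neg, zero_add]
        exact (inducedCon (locIdeal hP I)).symm ha }
  have hK : ∀ g : Multiplicative K, ∃ l : kˣ,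
      mono k (((g.toAdd : K) : AddUnits (Loc hP)) + w) - (l : k) • mono k w ∈ locIdeal hP I :=
    fun g => g.toAdd.2
  choose ρ hρ using hK
  have huniq : ∀ (g : Multiplicative K) (l : kˣ),
      mono k (((g.toAdd : K) : AddUnits (Loc hP)) + w) - (l : k) • mono k w ∈ locIdeal hP I →
      ρ g = l := fun g l hl => Units.ext (scalar_unique hw (hρ g) hl)
  refine ⟨K, ⟨⟨ρ, huniq 1 1 (by simp)⟩, fun a b => huniq _ _ ?_⟩, hw, fun _ => Iff.rfl,
    fun g hg => hρ (Multiplicative.ofAdd ⟨g, hg⟩), h⟩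
  have h1 := Ideal.mul_mem_left _ (mono k (((a.toAdd : K) : AddUnits (Loc hP)) : Loc hP)) (hρ b)
  rw [mono_mul_binomial] at h1
  have h2 := Ideal.add_mem _ h1 (ksmul_mem (ρ b : k) (hρ a))
  rw [smul_sub, smul_smul, sub_add_sub_cancel, mul_comm, ← Units.val_mul, ← add_assoc] at h2
  exact h2

/-- A character is preserved when `w` is replaced by an associate. -/
theorem HasChar.of_associate (h : HasChar hP ρ I w) {g v : Loc hP} (hg : IsAddUnit g)
    (hv : inducedCon (locIdeal hP I) (g + v) w) : HasChar hP ρ I v := by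
  have hiff : ∀ x : Loc hP, inducedCon (locIdeal hP I) (x + w) w ↔
      inducedCon (locIdeal hP I) (x + v) v := by
    intro x
    have hx := rel_add_left x hv
    rw [add_left_comm] at hx
    refine ⟨fun hw => rel_of_isAddUnit_add hg ?_, fun hv' => ?_⟩
    · exact (inducedCon _).trans hx ((inducedCon _).trans hw ((inducedCon _).symm hv))
    · exact (inducedCon _).trans ((inducedCon _).symm hx)
        ((inducedCon _).trans (rel_add_left g hv') hv)
  refine ⟨fun hm => h.mono_notMem ((mono_mem_iff_of_rel hv).1 (mono_add_mem g hm)),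
    fun g' => (h.mem_iff g').trans (hiff g'), fun g' hg' => ?_,
    fun x hx hx' => h.not_rel x hx ((hiff x).2 hx')⟩
  obtain ⟨l, hl⟩ := hv
  rw [← mono_mul_mem_iff hg, mono_mul_binomial]
  have h1 := Ideal.mul_mem_left _ (mono k (g' : Loc hP)) hl
  rw [mono_mul_binomial, add_left_comm] at h1
  have h2 := Ideal.add_mem _ h1 (ksmul_mem (l : k) (h.scalar g' hg'))
  have h3 := Ideal.sub_mem _ h2
    (ksmul_mem (ρ (Multiplicative.ofAdd ⟨g', hg'⟩) : k) hl)
  convert h3 using 1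
  simp only [smul_sub, smul_smul]
  rw [mul_comm (l : k)]
  abel

theorem charIdeal_sup_maxMono_inj {K' : AddSubgroup (AddUnits (Loc hP))}
    {ρ' : Multiplicative K' →* kˣ}
    (h : charIdeal hP ρ ⊔ maxMono hP k = charIdeal hP ρ' ⊔ maxMono hP k) : K ≤ K' := by
  intro g hg
  have := Ideal.mem_sup_left (T := maxMono hP k) (binomial_mem_charIdeal hP ρ hg)
  rw [h] at this
  exact (mem_of_binomial_mem_charIdeal_sup_maxMono hP ρ' (Units.ne_zero _) this).1

theorem mono_mem_mesoprime_iff {q : Q} : mono k q ∈ mesoprime hP ρ ↔ q ∈ P := by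
  rw [mesoprime, Ideal.mem_comap, locMap_mono]
  refine ⟨fun h => ?_, fun h => Ideal.mem_sup_right (Ideal.subset_span ⟨q, h, rfl⟩)⟩
  by_contra hq
  refine one_notMem_charIdeal_sup_maxMono hP ρ ?_
  rw [← mono_zero, ← mono_add_mem_iff (isAddUnit_toLoc hP hq), add_zero]
  exact h

end Character

/-! ### Components cogenerated by elements with a common character -/

section Component

variable {k : Type*} [Field k] {Q : Type*} [AddCommMonoid Q] {P : Set Q} (hP : IsPrimeIdeal P)
  {K : AddSubgroup (AddUnits (Loc hP))} (ρ : Multiplicative K →* kˣ)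
  (I : Ideal (AddMonoidAlgebra k Q)) (W : Set Q)

/-- Divisibility in `Q_P` modulo the congruence of `I_P`. -/
def LocLE (x y : Loc hP) : Prop := ∃ z : Loc hP, inducedCon (locIdeal hP I) (z + x) y

/-- The ideal of `k[Q]_P` whose preimage is `component hP I ρ W`. -/
def locComponent : Ideal (AddMonoidAlgebra k (Loc hP)) :=
  locIdeal hP I ⊔ charIdeal hP ρ ⊔ (cogenMono hP I W).map (locMap hP k)

theorem component_eq : component hP I ρ W = (locComponent hP ρ I W).comap (locMap hP k) := rfl

theorem locIdeal_component : locIdeal hP (component hP I ρ W) = locComponent hP ρ I W :=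
  locIdeal_comap hP _

theorem mem_orderIdeal_iff {u w : Q} :
    u ∈ orderIdeal hP I w ↔ LocLE hP I (toLoc hP u) (toLoc hP w) :=
  greenLE_mk_iff

variable {I} in
theorem locLE_add_iff {s x y : Loc hP} (hs : IsAddUnit s) :
    LocLE hP I (s + x) y ↔ LocLE hP I x y := by
  refine ⟨fun ⟨z, hz⟩ => ⟨z + s, by rwa [add_assoc]⟩, fun ⟨z, hz⟩ => ?_⟩
  obtain ⟨t, ht⟩ := isAddUnit_iff_exists_neg'.1 hs
  refine ⟨z + t, ?_⟩
  rwa [add_assoc, ← add_assoc t s x, ht, zero_add]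

theorem map_cogenMono_eq : (cogenMono hP I W).map (locMap hP k) =
    Ideal.span ((fun x => mono k x) '' {x : Loc hP | ∀ w ∈ W, ¬ LocLE hP I x (toLoc hP w)}) := by
  rw [cogenMono, Ideal.map_span]
  refine le_antisymm (Ideal.span_mono ?_) (Ideal.span_le.2 ?_)
  · rintro _ ⟨_, ⟨u, hu, rfl⟩, rfl⟩
    refine ⟨toLoc hP u, fun w hw h => hu w hw ((mem_orderIdeal_iff hP I).2 h), ?_⟩
    exact (locMap_mono hP u).symm
  · rintro _ ⟨x, hx, rfl⟩
    obtain ⟨q, s, hs, h⟩ := exists_toLoc_add_eq hP x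
    simp only [SetLike.mem_coe]
    rw [← mono_add_mem_iff (isAddUnit_toLoc hP hs), h]
    refine Ideal.subset_span ⟨_, ⟨q, fun w hw hq => hx w hw ?_, rfl⟩, locMap_mono hP q⟩
    rwa [mem_orderIdeal_iff, ← h, locLE_add_iff hP (isAddUnit_toLoc hP hs)] at hq

theorem locIdeal_le_locComponent : locIdeal hP I ≤ locComponent hP ρ I W :=
  le_sup_left.trans le_sup_left

theorem charIdeal_le_locComponent : charIdeal hP ρ ≤ locComponent hP ρ I W :=
  le_sup_right.trans le_sup_left

theorem le_component : I ≤ component hP I ρ W := fun _ hf =>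
  locIdeal_le_locComponent hP ρ I W (locMap_mem_locIdeal hP hf)

variable {hP ρ I W}

theorem isBinomialIdeal_locComponent (hI : IsBinomialIdeal I) :
    IsBinomialIdeal (locComponent hP ρ I W) := by
  rw [locComponent, map_cogenMono_eq]
  exact ((hI.locIdeal hP).sup (isBinomialIdeal_charIdeal hP ρ)).sup (isBinomialIdeal_span_mono _)

theorem isBinomialIdeal_component (hI : IsBinomialIdeal I) :
    IsBinomialIdeal (component hP I ρ W) :=
  (isBinomialIdeal_locComponent hI).comap (toLoc hP)

theorem locComponent_anti {W' : Set Q} (h : W' ⊆ W) :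
    locComponent hP ρ I W ≤ locComponent hP ρ I W' := by
  refine sup_le_sup_left ?_ _
  rw [map_cogenMono_eq, map_cogenMono_eq]
  exact Ideal.span_mono (Set.image_mono fun x hx w hw => hx w (h hw))

/-- The upper bound on the component from which its monomials, stabilizers and colon ideals are
computed. -/
theorem locComponent_le_classKernel (hI : IsBinomialIdeal I) {w : Q} (hw : w ∈ W)
    (h : HasChar hP ρ I (toLoc hP w)) :
    locComponent hP ρ I W ≤ classKernel (locIdeal hP I) (toLoc hP w) := by
  refine sup_le (sup_le (le_classKernel (hI.locIdeal hP) h.mono_notMem)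
    h.charIdeal_le_classKernel) ?_
  rw [map_cogenMono_eq]
  refine Ideal.span_le.2 ?_
  rintro _ ⟨x, hx, rfl⟩
  exact mono_mem_classKernel_iff.2 fun y hy => hx w hw ⟨y, hy⟩

theorem mono_mem_locComponent_iff (hI : IsBinomialIdeal I)
    (hW : ∀ w ∈ W, HasChar hP ρ I (toLoc hP w)) {x : Loc hP} :
    mono k x ∈ locComponent hP ρ I W ↔ ∀ w ∈ W, ¬ LocLE hP I x (toLoc hP w) := by
  refine ⟨fun h w hw ⟨z, hz⟩ => ?_, fun h => ?_⟩
  · exact mono_mem_classKernel_iff.1 (locComponent_le_classKernel hI hw (hW w hw) h) z hz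
  · refine Ideal.mem_sup_right ?_
    rw [map_cogenMono_eq]
    exact Ideal.subset_span ⟨x, h, rfl⟩

theorem exists_of_mono_notMem_locComponent {x : Loc hP} (hx : mono k x ∉ locComponent hP ρ I W) :
    ∃ w ∈ W, LocLE hP I x (toLoc hP w) := by
  by_contra! h
  refine hx (Ideal.mem_sup_right ?_)
  rw [map_cogenMono_eq]
  exact Ideal.subset_span ⟨x, h, rfl⟩

/-- The functional translated by `y` is nonzero at `z`, hence also at `g + z`; so `g` fixes the
class of `w`. -/
theorem HasChar.mem_of_rel_classKernel {w : Loc hP} (h : HasChar hP ρ I w)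
    {g : AddUnits (Loc hP)} {y z : Loc hP} (hyz : inducedCon (locIdeal hP I) (y + z) w)
    (hr : inducedCon (classKernel (locIdeal hP I) w) (g + z) z) : g ∈ K := by
  obtain ⟨l, hl⟩ := hr
  have h1 := hl y
  rw [mono_mul_binomial, map_sub, map_smul, sub_eq_zero] at h1
  have h2 : inducedCon (locIdeal hP I) (y + (g + z)) w := by
    rw [← classCoeff_mono_ne_zero_iff, h1]
    exact mul_ne_zero l.ne_zero (classCoeff_mono_ne_zero_iff.2 hyz)
  rw [add_left_comm] at h2
  exact (h.mem_iff g).2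
    ((inducedCon _).trans (rel_add_left (g : Loc hP) ((inducedCon _).symm hyz)) h2)

/-- At a monomial outside the component, the localized mesoprime of the component is that
of `ρ`. -/
theorem colon_locComponent_sup_eq (hI : IsBinomialIdeal I)
    (hW : ∀ w ∈ W, HasChar hP ρ I (toLoc hP w)) {x : Loc hP}
    (hx : mono k x ∉ locComponent hP ρ I W) :
    (locComponent hP ρ I W).colon {mono k x} ⊔ maxMono hP k = charIdeal hP ρ ⊔ maxMono hP k := by
  refine le_antisymm (sup_le (fun f hf => ?_) le_sup_right) (sup_le_sup_right (fun f hf => ?_) _)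
  · obtain ⟨w, hw, z, hz⟩ := exists_of_mono_notMem_locComponent hx
    refine (hW w hw).mem_of_mul_mono_mem_classKernel ?_
    have hle := locComponent_le_classKernel hI hw (hW w hw)
    have h1 := hle (Ideal.mul_mem_left _ (mono k z) (Submodule.mem_colon_singleton.1 hf))
    obtain ⟨l, hl⟩ := hz
    have h2 := Ideal.mul_mem_left _ f (hle (locIdeal_le_locComponent hP ρ I W hl))
    rw [smul_eq_mul, mul_left_comm, ← mono_add] at h1
    have h3 := Ideal.sub_mem _ h1 h2
    rw [mul_sub, sub_sub_cancel, mul_smul_comm] at h3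
    exact mem_of_ksmul_mem l.ne_zero h3
  · exact Submodule.mem_colon_singleton.2
      (Ideal.mul_mem_right _ _ (charIdeal_le_locComponent hP ρ I W hf))

theorem zero_notMem_locComponent (hI : IsBinomialIdeal I)
    (hW : ∀ w ∈ W, HasChar hP ρ I (toLoc hP w)) (hne : W.Nonempty) :
    mono k (0 : Loc hP) ∉ locComponent hP ρ I W := by
  obtain ⟨w, hw⟩ := hne
  intro h
  refine (mono_mem_locComponent_iff hI hW).1 h w hw ⟨toLoc hP w, ?_⟩
  rw [add_zero]
  exact (inducedCon _).refl _

/-- Every component is the intersection of the coprincipal components. -/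
theorem component_eq_iInf (hI : IsBinomialIdeal I)
    (hW : ∀ w ∈ W, HasChar hP ρ I (toLoc hP w)) :
    component hP I ρ W = ⨅ w ∈ W, component hP I ρ {w} := by
  refine le_antisymm (le_iInf₂ fun w hw => Ideal.comap_mono
    (locComponent_anti (Set.singleton_subset_iff.2 hw))) fun f hf => ?_
  simp only [Ideal.mem_iInf, component_eq, Ideal.mem_comap] at hf ⊢
  generalize locMap hP k f = F at hf
  set L := locIdeal hP I ⊔ charIdeal hP ρ with hL
  have hLb : IsBinomialIdeal L := (hI.locIdeal hP).sup (isBinomialIdeal_charIdeal hP ρ)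
  have hLle : ∀ W' : Set Q, L ≤ locComponent hP ρ I W' := fun W' => le_sup_left
  obtain ⟨F₀, h₁, -, h₂⟩ := exists_isReduced L F
  replace h₁ := binomialPart_le _ h₁
  suffices F₀ ∈ locComponent hP ρ I W by
    simpa using Ideal.add_mem _ (hLle W h₁) this
  have hF₀ : ∀ w ∈ W, F₀ ∈ locComponent hP ρ I {w} := fun w hw => by
    have := Ideal.sub_mem _ (hf w hw) (hLle _ h₁)
    rwa [sub_sub_cancel] at this
  refine mem_of_forall_mono_mem ((locComponent hP ρ I W).restrictScalars k) fun u hu => ?_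
  refine (mono_mem_locComponent_iff hI hW).2 fun w hw hle => ?_
  have hW' : ∀ w' ∈ ({w} : Set Q), HasChar hP ρ I (toLoc hP w') := by
    rintro _ rfl; exact hW _ hw
  have hu' : mono k u ∉ locComponent hP ρ I {w} := fun h =>
    (mono_mem_locComponent_iff hI hW').1 h w rfl hle
  -- The cogenerating monomials lie in the component at `w` and `t^u` does not, so none of their
  -- multiples is congruent to `u` modulo `L`.
  have hker : ∀ G ∈ locComponent hP ρ I {w}, classCoeff L u G = 0 := by
    intro G hG
    rw [locComponent, map_cogenMono_eq] at hG
    obtain ⟨a, ha, b, hb, rfl⟩ := Submodule.mem_sup.1 hG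
    rw [map_add, classCoeff_eq_zero hLb (fun h => hu' (hLle _ h)) ha, zero_add]
    refine mem_of_mem_span (LinearMap.ker (classCoeff L u)) (fun r s hs => ?_) hb
    obtain ⟨x, hx, rfl⟩ := hs
    rw [LinearMap.mem_ker, ← mono_add]
    refine classCoeff_mono_eq_zero fun hr => hu' ?_
    refine (mono_mem_iff_of_rel (inducedCon_mono (hLle _) hr)).1 (mono_add_mem r ?_)
    exact (mono_mem_locComponent_iff hI hW').2 hx
  have h0 := hker F₀ (hF₀ w hw)
  rw [linearMap_apply_of_isolated _ (u := u)] at h0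
  · exact mul_ne_zero (Finsupp.mem_support_iff.1 hu) classCoeff_self_ne_zero h0
  · exact fun v hv hvu => classCoeff_mono_eq_zero fun h => hvu (h₂.eq_of_rel v hv u hu h)

theorem inducedCon_component_iff {a b : Q} : inducedCon (component hP I ρ W) a b ↔
    inducedCon (locComponent hP ρ I W) (toLoc hP a) (toLoc hP b) := by
  refine exists_congr fun l => ?_
  rw [component_eq, Ideal.mem_comap, locMap_binomial]

theorem mono_mem_component_iff {a : Q} : mono k a ∈ component hP I ρ W ↔
    mono k (toLoc hP a) ∈ locComponent hP ρ I W := by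
  rw [component_eq, Ideal.mem_comap, locMap_mono]

end Component

/-! ### Finitely generated monoids -/

section Dickson

variable {Q : Type*} [AddCommMonoid Q]

instance isPreorder_exists_add : IsPreorder Q (fun a b : Q => ∃ c, b = a + c) where
  refl a := ⟨0, (add_zero a).symm⟩
  trans := by
    rintro a _ _ ⟨c, rfl⟩ ⟨d, rfl⟩
    exact ⟨c + d, add_assoc a c d⟩

/-- Divisibility in a finitely generated commutative monoid is a well-quasi-order. -/
theorem wellQuasiOrdered_exists_add [AddMonoid.FG Q] :
    WellQuasiOrdered (fun a b : Q => ∃ c, b = a + c) := by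
  obtain ⟨S, hS⟩ := (AddMonoid.fg_def (M := Q)).1 inferInstance
  intro f
  have hf : ∀ n, ∃ a : S →₀ ℕ, f n = a.sum fun i m => m • (i : Q) := fun n =>
    AddSubmonoid.exists_finsupp_of_mem_closure_range (fun i : S => (i : Q)) (f n) (by
      rw [Subtype.range_coe_subtype]
      change f n ∈ AddSubmonoid.closure (S : Set Q)
      rw [hS]; trivial)
  choose a ha using hf
  obtain ⟨m, n, hmn, hle⟩ := (wellQuasiOrdered_le (α := S →₀ ℕ)) a
  refine ⟨m, n, hmn, (a n - a m).sum fun i m => m • (i : Q), ?_⟩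
  rw [ha n, ha m, ← Finsupp.sum_add_index' (by simp) (by intros; rw [add_smul]),
    add_tsub_cancel_of_le hle]

end Dickson

/-! ### Components are mesoprimary -/

section Mesoprimary

variable {k : Type*} [Field k] {Q : Type*} [AddCommMonoid Q] {P : Set Q} {hP : IsPrimeIdeal P}
  {K : AddSubgroup (AddUnits (Loc hP))} {ρ : Multiplicative K →* kˣ}
  {I : Ideal (AddMonoidAlgebra k Q)} {W : Set Q}

/-- Otherwise `q n + n • p ∼ s n + w` for all `n`, with `s n ∉ P`. Dickson's lemma gives `i < j`
with `q j = q i + c` and `s j = s i + d`. Comparing the two relations and cancelling `s i`, the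
nonunit `c + (j - i) • p - d` fixes the class of `w`. -/
theorem HasChar.exists_not_locLE_nsmul [AddMonoid.FG Q] {w : Q} (h : HasChar hP ρ I (toLoc hP w))
    {p : Q} (hp : p ∈ P) : ∃ n : ℕ, ¬ LocLE hP I (toLoc hP (n • p)) (toLoc hP w) := by
  by_contra! hle
  have hle' : ∀ n : ℕ, ∃ q s : Q, s ∉ P ∧
      inducedCon (locIdeal hP I) (toLoc hP (q + n • p)) (toLoc hP (s + w)) := by
    intro n
    obtain ⟨z, hz⟩ := hle n
    obtain ⟨q, s, hs, hqs⟩ := exists_toLoc_add_eq hP z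
    refine ⟨q, s, hs, ?_⟩
    rw [map_add (toLoc hP), ← hqs, add_assoc, map_add (toLoc hP)]
    exact rel_add_left _ hz
  choose q s hs hr using hle'
  obtain ⟨i, j, hij, ⟨c, hc⟩, ⟨d, hd⟩⟩ :=
    (wellQuasiOrdered_exists_add (Q := Q)).prod (wellQuasiOrdered_exists_add (Q := Q))
      fun n => (q n, s n)
  simp only at hc hd
  have hdP : d ∉ P := fun hdP => hs j (hd ▸ hP.add_mem _ _ hdP)
  obtain ⟨e, he⟩ := isAddUnit_iff_exists_neg'.1 (isAddUnit_toLoc hP hdP)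
  obtain ⟨m, rfl⟩ := Nat.exists_eq_add_of_lt hij
  refine h.not_rel (e + toLoc hP (c + (m + 1) • p)) (fun hu => ?_) ?_
  · refine (isAddUnit_toLoc_iff hP).1 (IsAddUnit.add_iff.1 hu).2 ?_
    rw [succ_nsmul]
    exact hP.add_mem _ _ (hP.add_mem _ _ hp)
  · refine rel_of_isAddUnit_add (isAddUnit_toLoc hP hdP)
      (rel_of_isAddUnit_add (isAddUnit_toLoc hP (hs i)) ?_)
    have h1 := hr (i + m + 1)
    have h2 := rel_add_left (toLoc hP (c + (m + 1) • p)) (hr i)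
    have e1 : toLoc hP (c + (m + 1) • p) + toLoc hP (q i + i • p) =
        toLoc hP (q (i + m + 1) + (i + m + 1) • p) := by
      rw [← map_add, hc, add_assoc i m 1, add_smul i (m + 1) p]
      congr 1
      abel
    rw [e1] at h2
    have h3 := (inducedCon _).trans ((inducedCon _).symm h2) h1
    have e2 : toLoc hP (s i) + (toLoc hP d + (e + toLoc hP (c + (m + 1) • p) + toLoc hP w)) =
        toLoc hP (c + (m + 1) • p) + toLoc hP (s i + w) := by
      rw [← add_assoc (toLoc hP d), ← add_assoc (toLoc hP d), add_comm (toLoc hP d) e, he, zero_add,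
        add_left_comm, map_add _ (s i) w]
    rw [e2]
    rwa [hd, add_assoc, map_add (toLoc hP) (s i) (d + w), map_add (toLoc hP) d w] at h3

theorem exists_mono_nsmul_mem_component [AddMonoid.FG Q] (hI : IsBinomialIdeal I) (hfin : W.Finite)
    (hW : ∀ w ∈ W, HasChar hP ρ I (toLoc hP w)) {p : Q} (hp : p ∈ P) :
    ∃ n : ℕ, mono k (n • p) ∈ component hP I ρ W := by
  simp only [mono_mem_component_iff, mono_mem_locComponent_iff hI hW]
  have : ∀ w ∈ W, ∃ n : ℕ, ¬ LocLE hP I (toLoc hP (n • p)) (toLoc hP w) := fun w hw =>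
    (hW w hw).exists_not_locLE_nsmul hp
  choose! n hn using this
  obtain ⟨N, hN⟩ := (hfin.image n).bddAbove
  refine ⟨N, fun w hw ⟨z, hz⟩ => hn w hw ⟨z + toLoc hP ((N - n w) • p), ?_⟩⟩
  rwa [add_assoc, ← map_add, ← add_smul, Nat.sub_add_cancel (hN ⟨w, hw, rfl⟩)]

theorem IsCanc.nsmul {M : Type*} [AddCommMonoid M] {a : M} (ha : IsCanc a) (n : ℕ) :
    IsCanc (n • a) := by
  induction n with
  | zero => intro x y h; simpa using h
  | succ n ih =>
    intro x y h
    rw [succ_nsmul, add_assoc, add_assoc] at h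
    exact ha _ _ (ih _ _ h)

/-- Disposes of the trivial quotient, the only one in which the class of an element of `P` can be
cancellative. -/
theorem IsCanc.eq_of_isNilp {M : Type*} [AddCommMonoid M] {a : M} (ha : IsCanc a) (h : IsNilp a)
    (x y : M) : x = y := by
  obtain ⟨n, hn⟩ := h
  exact ha.nsmul n x y (by rw [add_comm, hn x, add_comm, hn y])

/-- Elements outside `P` become units in `Q_P`, so they cancel. For partial cancellativity, two
elements outside `P` differ by a unit of `Q_P`; if they agree after adding `x`, away from the
component, that unit lies in `K`, and `I_ρ` already identifies them. -/
theorem isMesoprimaryCon_component [AddMonoid.FG Q] (hI : IsBinomialIdeal I) (hfin : W.Finite)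
    (hW : ∀ w ∈ W, HasChar hP ρ I (toLoc hP w)) :
    IsMesoprimaryCon (inducedCon (component hP I ρ W)) := by
  set c := inducedCon (component hP I ρ W) with hc
  have hnil : ∀ p ∈ P, IsNilp (c.mk' p) := fun p hp => by
    obtain ⟨n, hn⟩ := exists_mono_nsmul_mem_component hI hfin hW hp
    exact ⟨n, by rw [← map_nsmul]; exact isNil_of_mono_mem hn⟩
  refine ⟨fun x => ?_, fun x a b ha hb hab hx => ?_⟩
  · obtain ⟨q, rfl⟩ := AddCon.mk'_surjective x
    by_cases hq : q ∈ P
    · exact Or.inl (hnil q hq)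
    refine Or.inr fun a b h => ?_
    obtain ⟨a, rfl⟩ := AddCon.mk'_surjective a
    obtain ⟨b, rfl⟩ := AddCon.mk'_surjective b
    have h1 := c.eq.1 h
    rw [hc, inducedCon_component_iff] at h1
    simp only [map_add (toLoc hP)] at h1
    exact c.eq.2 (inducedCon_component_iff.2
      (rel_of_isAddUnit_add (isAddUnit_toLoc hP hq) h1))
  · obtain ⟨x, rfl⟩ := AddCon.mk'_surjective x
    obtain ⟨a, rfl⟩ := AddCon.mk'_surjective a
    obtain ⟨b, rfl⟩ := AddCon.mk'_surjective b
    by_cases haP : a ∈ P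
    · exact ha.eq_of_isNilp (hnil a haP) _ _
    by_cases hbP : b ∈ P
    · exact hb.eq_of_isNilp (hnil b hbP) _ _
    have hxa : mono k (toLoc hP (x + a)) ∉ locComponent hP ρ I W := fun h =>
      hx (isNil_of_mono_mem (mono_mem_component_iff.2 h))
    obtain ⟨w, hw, y, hy⟩ := exists_of_mono_notMem_locComponent hxa
    obtain ⟨ga, hga⟩ := isAddUnit_toLoc hP haP
    obtain ⟨gb, hgb⟩ := isAddUnit_toLoc hP hbP
    have hba : ((gb - ga : AddUnits (Loc hP)) : Loc hP) + toLoc hP a = toLoc hP b := by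
      rw [← hga, ← hgb, ← AddUnits.val_add, sub_add_cancel]
    have h1 := inducedCon_component_iff.1 (c.eq.1 hab.symm)
    have hK : gb - ga ∈ K := by
      refine (hW w hw).mem_of_rel_classKernel hy ?_
      have h2 := inducedCon_mono (locComponent_le_classKernel hI hw (hW w hw)) h1
      rwa [map_add _ x b, ← hba, add_left_comm, ← map_add] at h2
    have h2 := charIdeal_le_locComponent hP ρ I W
      (binomial_add_mem_charIdeal hP ρ hK (toLoc hP a))
    rw [hba] at h2
    exact c.eq.2 (c.symm (inducedCon_component_iff.2 ⟨_, h2⟩))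

/-- For maximality, a larger proper binomial ideal with the same congruence has no new monomials:
for `q ∈ P`, `q` is congruent to its multiples, some of which lie in the component; for `q ∉ P`,
cancellation would give `q ∼ 0`. Scalars of the remaining binomials are then unique. -/
theorem isPMesoprimary_component [AddMonoid.FG Q] (hI : IsBinomialIdeal I) (hfin : W.Finite)
    (hne : W.Nonempty) (hW : ∀ w ∈ W, HasChar hP ρ I (toLoc hP w)) :
    IsPMesoprimary P (component hP I ρ W) := by
  have h0 := zero_notMem_locComponent hI hW hne
  refine ⟨⟨isBinomialIdeal_component hI, ?_, isMesoprimaryCon_component hI hfin hW, ?_⟩, ?_⟩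
  · intro h
    refine h0 ?_
    rw [← map_zero (toLoc hP), ← mono_mem_component_iff, h]
    trivial
  · intro I' hI' htop hcon hle
    have hmono : ∀ q, mono k q ∈ I' → mono k q ∈ component hP I ρ W := by
      intro q hq
      by_cases hqP : q ∈ P
      · obtain ⟨n, hn⟩ := exists_mono_nsmul_mem_component hI hfin hW hqP
        have h1 : inducedCon I' (q + n • q) q :=
          rel_of_mono_mem (mono_add_mem q (hle hn)) hq
        rw [hcon] at h1
        exact (mono_mem_iff_of_rel h1).1 (mono_add_mem q hn)
      · exfalso
        have h1 : inducedCon I' (q + q) q := rel_of_mono_mem (mono_add_mem q hq) hq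
        rw [hcon, inducedCon_component_iff, map_add (toLoc hP)] at h1
        have h2 : inducedCon I' q 0 := by
          rw [hcon, inducedCon_component_iff, map_zero]
          exact rel_of_isAddUnit_add (isAddUnit_toLoc hP hqP) (by rwa [add_zero])
        have h3 := (mono_mem_iff_of_rel h2).1 hq
        rw [mono_zero] at h3
        exact htop ((Ideal.eq_top_iff_one _).2 h3)
    refine le_antisymm (le_of_binomials_mem hI' fun p q l h => ?_) hle
    rcases eq_or_ne l 0 with rfl | hl
    · rw [zero_smul, sub_zero] at h ⊢
      exact hmono p h
    · have h1 : inducedCon I' p q := ⟨Units.mk0 l hl, h⟩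
      by_cases hq : mono k q ∈ I'
      · have hp := (mono_mem_iff_of_rel h1).2 hq
        exact Ideal.sub_mem _ (hmono p hp) (ksmul_mem l (hmono q hq))
      · have h2 := h1
        rw [hcon] at h2
        obtain ⟨m, hm⟩ := h2
        rwa [scalar_unique hq h (hle hm)]
  · ext q
    refine ⟨fun hq => exists_mono_nsmul_mem_component hI hfin hW hq, fun ⟨n, hn⟩ => ?_⟩
    by_contra hq
    have hu : IsAddUnit (toLoc hP (n • q)) := isAddUnit_toLoc hP (hP.compl.nsmul_mem hq n)
    rw [mono_mem_component_iff, ← add_zero (toLoc hP (n • q)), mono_add_mem_iff hu] at hn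
    exact h0 hn

end Mesoprimary

/-! ### Witnesses and socles -/

section Witness

variable {k : Type*} [Field k] {Q : Type*} [AddCommMonoid Q] {P : Set Q} (hP : IsPrimeIdeal P)
  (I : Ideal (AddMonoidAlgebra k Q))

/-- Adding any `p ∈ P` identifies the class of `x` with another class. -/
def IsMerged (x : Loc hP) : Prop :=
  ∀ p ∈ P, ∃ y : Loc hP, ¬ inducedCon (locIdeal hP I) y x ∧
    inducedCon (locIdeal hP I) (toLoc hP p + y) (toLoc hP p + x)

variable {hP I} {K : AddSubgroup (AddUnits (Loc hP))} {ρ : Multiplicative K →* kˣ} {W : Set Q}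

theorem IsWitness.isMerged {w : Q} (h : IsWitness hP I w) : IsMerged hP I (toLoc hP w) := by
  intro p hp
  obtain ⟨b, hb, hpb⟩ := h.2.2 p hp
  obtain ⟨y, rfl⟩ := AddCon.mk'_surjective b
  exact ⟨y, fun hy => hb ((inducedCon _).eq.2 hy), (inducedCon _).eq.1 hpb⟩

theorem HasChar.isWitness {w : Q} (h : HasChar hP ρ I (toLoc hP w))
    (hw : IsMerged hP I (toLoc hP w)) : IsWitness hP I w := by
  refine ⟨h.mono_notMem, fun ⟨p, hp⟩ hnil => ?_, fun p hp => ?_⟩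
  · exact h.not_rel (toLoc hP p) (fun hu => (isAddUnit_toLoc_iff hP).1 hu hp)
      (isNil_mk_iff.1 hnil (toLoc hP p))
  · obtain ⟨y, hy, hpy⟩ := hw p hp
    exact ⟨(inducedCon _).mk' y, fun h => hy ((inducedCon _).eq.1 h), (inducedCon _).eq.2 hpy⟩

theorem IsMerged.of_associate {w g v : Loc hP} (h : IsMerged hP I w) (hg : IsAddUnit g)
    (hv : inducedCon (locIdeal hP I) (g + v) w) : IsMerged hP I v := by
  intro p hp
  obtain ⟨y, hy, hpy⟩ := h p hp
  obtain ⟨e, he⟩ := isAddUnit_iff_exists_neg.1 hg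
  have hey : g + (e + y) = y := by rw [← add_assoc, he, zero_add]
  refine ⟨e + y, fun h' => hy ?_, rel_of_isAddUnit_add hg ?_⟩
  · have := rel_add_left g h'
    rw [hey] at this
    exact (inducedCon _).trans this hv
  · rw [add_left_comm, hey, add_left_comm]
    exact (inducedCon _).trans hpy (rel_add_left _ ((inducedCon _).symm hv))

/-- The socle of a component consists of associates of its cogenerators. -/
theorem exists_associate_of_inSocle (hI : IsBinomialIdeal I)
    (hW : ∀ w ∈ W, HasChar hP ρ I (toLoc hP w)) {u : Q}
    (hu : InSocle hP (component hP I ρ W) u) :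
    ∃ w ∈ W, ∃ g : Loc hP, IsAddUnit g ∧
      inducedCon (locIdeal hP I) (g + toLoc hP u) (toLoc hP w) := by
  obtain ⟨h1, h2⟩ := hu
  rw [locIdeal_component] at h1 h2
  obtain ⟨w, hw, z, hz⟩ := exists_of_mono_notMem_locComponent h1
  refine ⟨w, hw, z, ?_, hz⟩
  -- If `z` were a nonunit, the socle condition would put `t^(z + u)` in the component, although `z
  -- + u` is congruent to the cogenerator `w`.
  by_contra hzu
  have h3 := h2 _ (mono_mem_maxMono hP hzu)
  rw [← mono_add] at h3
  refine (mono_mem_locComponent_iff hI hW).1 h3 w hw ⟨0, ?_⟩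
  rwa [zero_add]

theorem isWitness_of_inSocle (hI : IsBinomialIdeal I)
    (hW : ∀ w ∈ W, HasChar hP ρ I (toLoc hP w)) (hW' : ∀ w ∈ W, IsWitness hP I w) {u : Q}
    (hu : InSocle hP (component hP I ρ W) u) : IsWitness hP I u := by
  obtain ⟨w, hw, g, hg, h⟩ := exists_associate_of_inSocle hI hW hu
  exact ((hW w hw).of_associate hg h).isWitness ((hW' w hw).isMerged.of_associate hg h)

theorem locMesoprimeAt_component (hI : IsBinomialIdeal I)
    (hW : ∀ w ∈ W, HasChar hP ρ I (toLoc hP w)) {u : Q}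
    (hu : mono k (toLoc hP u) ∉ locComponent hP ρ I W) :
    locMesoprimeAt hP (component hP I ρ W) u = charIdeal hP ρ ⊔ maxMono hP k := by
  rw [locMesoprimeAt, locIdeal_component]
  exact colon_locComponent_sup_eq hI hW hu

/-- Both sides are the mesoprime of `ρ`: for `I` because `u` is an associate of a cogenerator, for
the component because `t^u` lies outside it. -/
theorem mesoprimeAt_eq_of_inSocle (hI : IsBinomialIdeal I)
    (hW : ∀ w ∈ W, HasChar hP ρ I (toLoc hP w)) {u : Q}
    (hu : InSocle hP (component hP I ρ W) u) :
    mesoprimeAt hP I u = mesoprimeAt hP (component hP I ρ W) u := by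
  obtain ⟨w, hw, g, hg, h⟩ := exists_associate_of_inSocle hI hW hu
  have h1 := hu.1
  rw [locIdeal_component] at h1
  rw [mesoprimeAt, mesoprimeAt, locMesoprimeAt_component hI hW h1, locMesoprimeAt,
    ((hW w hw).of_associate hg h).colon_sup_eq hI]

theorem LocLE.refl (x : Loc hP) : LocLE hP I x x :=
  ⟨0, by rw [zero_add]; exact (inducedCon _).refl x⟩

theorem LocLE.trans {x y z : Loc hP} (hxy : LocLE hP I x y) (hyz : LocLE hP I y z) :
    LocLE hP I x z := by
  obtain ⟨a, ha⟩ := hxy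
  obtain ⟨b, hb⟩ := hyz
  exact ⟨b + a, by rw [add_assoc]; exact (inducedCon _).trans (rel_add_left b ha) hb⟩

/-- Comparing sets of divisors turns the divisibility preorder into inclusion. -/
theorem exists_maximal_locLE (hfin : W.Finite) (hne : W.Nonempty) :
    ∃ w ∈ W, ∀ v ∈ W, LocLE hP I (toLoc hP w) (toLoc hP v) →
      LocLE hP I (toLoc hP v) (toLoc hP w) := by
  obtain ⟨w, hw, hmax⟩ := hfin.exists_maximalFor (fun w => {y | LocLE hP I y (toLoc hP w)}) W hne
  exact ⟨w, hw, fun v hv h => hmax hv (fun y hy => LocLE.trans hy h) (LocLE.refl _)⟩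

theorem exists_minimal_locLE {s : Set (Loc hP)} (hfin : s.Finite) (hne : s.Nonempty) :
    ∃ w ∈ s, ∀ v ∈ s, LocLE hP I v w → LocLE hP I w v := by
  obtain ⟨w, hw, hmin⟩ := hfin.exists_minimalFor (fun w => {y | LocLE hP I y w}) s hne
  exact ⟨w, hw, fun v hv h => hmin hv (fun y hy => LocLE.trans hy h) (LocLE.refl _)⟩

/-- A cogenerator maximal for divisibility is a witness for the component itself. Conversely, any
witness must be for `P`, and the mesoprime at every monomial outside the component is that of `ρ`.
-/
theorem assMesoprimes_component [AddMonoid.FG Q] (hI : IsBinomialIdeal I) (hfin : W.Finite)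
    (hne : W.Nonempty) (hW : ∀ w ∈ W, HasChar hP ρ I (toLoc hP w)) :
    assMesoprimes (component hP I ρ W) = {mesoprime hP ρ} := by
  refine Set.eq_singleton_iff_unique_mem.2 ⟨?_, ?_⟩
  · obtain ⟨w, hw, hmax⟩ := exists_maximal_locLE (I := I) (hP := hP) hfin hne
    have hw1 : mono k (toLoc hP w) ∉ locComponent hP ρ I W := fun h =>
      (mono_mem_locComponent_iff hI hW).1 h w hw (LocLE.refl _)
    -- If `p + w` divided some `v ∈ W`, maximality would make `v` divide `w`, and a nonunit would
    -- fix the class of `w`.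
    have hp : ∀ p ∈ P, mono k (toLoc hP p + toLoc hP w) ∈ locComponent hP ρ I W := by
      intro p hp
      refine (mono_mem_locComponent_iff hI hW).2 fun v hv ⟨z, hz⟩ => ?_
      obtain ⟨d, hd⟩ := hmax v hv ⟨z + toLoc hP p, by rwa [add_assoc]⟩
      refine (hW w hw).not_rel (d + z + toLoc hP p)
        (fun hu => (isAddUnit_toLoc_iff hP).1 (IsAddUnit.add_iff.1 hu).2 hp) ?_
      rw [add_assoc, add_assoc]
      exact (inducedCon _).trans (rel_add_left d hz) hd
    refine ⟨P, hP, K, ρ, w, ?_, ⟨?_, ?_⟩, rfl⟩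
    · rw [← locIdeal_component] at hw1
      simp only [← locIdeal_component] at hp
      refine ⟨hw1, fun ⟨p, hpP⟩ hnil => ?_, fun p hpP => ?_⟩
      · exact hw1 ((mono_mem_iff_of_rel (isNil_mk_iff.1 hnil (toLoc hP p))).1 (hp p hpP))
      · refine ⟨(inducedCon _).mk' (toLoc hP p + toLoc hP w), fun h => hw1 ?_, ?_⟩
        · exact (mono_mem_iff_of_rel ((inducedCon _).eq.1 h)).1 (hp p hpP)
        · exact (inducedCon _).eq.2
            (rel_of_mono_mem (mono_add_mem _ (hp p hpP)) (hp p hpP))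
    · ext g
      rw [mem_stab_iff, locIdeal_component]
      refine ⟨fun hg => ⟨_, charIdeal_le_locComponent hP ρ I W
        (binomial_add_mem_charIdeal hP ρ hg _)⟩, fun hg => ?_⟩
      refine (hW w hw).mem_of_rel_classKernel (y := 0) (z := toLoc hP w) ?_
        (inducedCon_mono (locComponent_le_classKernel hI hw (hW w hw)) hg)
      rw [zero_add]
      exact (inducedCon _).refl _
    · exact (locMesoprimeAt_component hI hW hw1).symm
  · rintro _ ⟨P', hP', K', ρ', w, hwit, hchar, rfl⟩
    -- An element of `P` outside `P'` would be both nilpotent modulo the component and invertible in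
    -- the localization at `P'`.
    have hle : P ⊆ P' := by
      intro p hp
      by_contra hp'
      obtain ⟨n, hn⟩ := exists_mono_nsmul_mem_component hI hfin hW hp
      have h1 := locMap_mem_locIdeal hP' hn
      rw [locMap_mono] at h1
      refine hwit.1 ?_
      rw [← mono_add_mem_iff (isAddUnit_toLoc hP' (hP'.compl.nsmul_mem hp' n)), add_comm]
      exact mono_add_mem _ h1
    -- An element `s` outside `P` is cancellable modulo the component, so adding it cannot merge the
    -- witness with another class.
    have hge : P' ⊆ P := by
      intro s hs
      by_contra hsP
      obtain ⟨y, hy, l, hl⟩ := hwit.isMerged s hs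
      refine hy ⟨l, ?_⟩
      obtain ⟨t, ht, f, hf⟩ :=
        exists_mul_eq_locMap hP' (mono k y - (l : k) • mono k (toLoc hP' w))
      rw [← mono_mul_mem_iff (isAddUnit_toLoc hP' ht), hf]
      rw [← mono_mul_binomial] at hl
      have h1 := Ideal.mul_mem_left _ (mono k (toLoc hP' t)) hl
      rw [mul_left_comm, hf, ← locMap_mono, ← map_mul, locMap_mem_locIdeal_iff] at h1
      obtain ⟨r, hr, h2⟩ := h1
      refine locMap_mem_locIdeal hP' ?_
      have hrP : r ∉ P := fun h => hr (hle h)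
      rw [component_eq, Ideal.mem_comap, map_mul, map_mul, locMap_mono, locMap_mono,
        mono_mul_mem_iff (isAddUnit_toLoc hP hrP), mono_mul_mem_iff (isAddUnit_toLoc hP hsP)] at h2
      exact h2
    obtain rfl : P = P' := Set.Subset.antisymm hle hge
    have h1 := hwit.1
    rw [locIdeal_component] at h1
    rw [mesoprime, hchar.2, locMesoprimeAt_component hI hW h1, mesoprime]

end Witness

/-! ### Separating elements from the ideal -/

section Separation

variable {k : Type*} [Field k] {Q : Type*} [AddCommMonoid Q]

theorem isNoetherianRing_addMonoidAlgebra [AddMonoid.FG Q] :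
    IsNoetherianRing (AddMonoidAlgebra k Q) :=
  Algebra.FiniteType.isNoetherianRing k _

/-- The elements of `k[Q]` annihilated by `m_P` modulo `I_P`. -/
def socleIdeal {P : Set Q} (hP : IsPrimeIdeal P) (I : Ideal (AddMonoidAlgebra k Q)) :
    Ideal (AddMonoidAlgebra k Q) :=
  ((locIdeal hP I).colon (maxMono hP k : Set (AddMonoidAlgebra k (Loc hP)))).comap (locMap hP k)

variable {P : Set Q} (hP : IsPrimeIdeal P) (I : Ideal (AddMonoidAlgebra k Q))

theorem mem_socleIdeal_iff {f : AddMonoidAlgebra k Q} : f ∈ socleIdeal hP I ↔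
    ∀ g ∈ maxMono hP k, locMap hP k f * g ∈ locIdeal hP I := by
  rw [socleIdeal, Ideal.mem_comap, Submodule.mem_colon]
  rfl

/-- Modulo `I_P`, the elements of the socle ideal are supported on translates, by elements outside
of `P`, of a finite set. -/
theorem exists_finite_support_socleIdeal [AddMonoid.FG Q] :
    ∃ F : Set Q, F.Finite ∧ ∀ f ∈ socleIdeal hP I,
    ∃ f₁ : AddMonoidAlgebra k Q, (∀ u ∈ f₁.coeff.support, ∃ a ∈ F, ∃ s ∉ P, u = s + a) ∧
      locMap hP k (f - f₁) ∈ locIdeal hP I := by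
  have := isNoetherianRing_addMonoidAlgebra (k := k) (Q := Q)
  obtain ⟨G, hG⟩ := (isNoetherianRing_iff_ideal_fg _).1 this (socleIdeal hP I)
  refine ⟨⋃ g ∈ G, (g.coeff.support : Set Q),
    G.finite_toSet.biUnion fun g _ => Finset.finite_toSet _, fun f hf => ?_⟩
  set E : Set Q := {u | ∃ a ∈ ⋃ g ∈ G, (g.coeff.support : Set Q), ∃ s ∉ P, u = s + a} with hE
  -- A multiple `t^r g` of a generator lies in `I_P` if `r ∈ P`, and is supported on `E` otherwise.
  let V : Submodule k (AddMonoidAlgebra k Q) :=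
    supported k k E ⊔ ((locIdeal hP I).comap (locMap hP k)).restrictScalars k
  have hV : f ∈ V := by
    rw [← hG] at hf
    refine mem_of_mem_span V (fun r g hg => ?_) hf
    by_cases hr : r ∈ P
    · refine Submodule.mem_sup_right ?_
      have h1 : g ∈ socleIdeal hP I := hG ▸ Ideal.subset_span hg
      have h2 := (mem_socleIdeal_iff hP I).1 h1 (mono k (toLoc hP r))
        (Ideal.subset_span ⟨r, hr, rfl⟩)
      rw [Submodule.restrictScalars_mem, Ideal.mem_comap, map_mul, locMap_mono, mul_comm]
      exact h2
    · refine Submodule.mem_sup_left ?_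
      refine mem_of_forall_mono_mem
        ((supported k k E).comap (LinearMap.mulLeft k (mono k r))) fun v hv => ?_
      rw [Submodule.mem_comap, LinearMap.mulLeft_apply, ← mono_add, mem_supported']
      intro m hm
      rw [mono, coeff_single, Finsupp.single_apply_eq_zero]
      rintro rfl
      exact absurd ⟨v, Set.mem_biUnion hg hv, r, hr, rfl⟩ hm
  obtain ⟨f₁, h₁, f₂, h₂, rfl⟩ := Submodule.mem_sup.1 hV
  refine ⟨f₁, fun u hu => h₁ hu, ?_⟩
  rw [add_sub_cancel_left]
  exact h₂

/-- Elements of the socle ideal outside of `I_P` are separated from `I` by coprincipal components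
cogenerated by finitely many witnesses. -/
theorem exists_finite_separating [AddMonoid.FG Q] (hI : IsBinomialIdeal I) :
    ∃ F : Set Q, F.Finite ∧
    ∀ f ∈ socleIdeal hP I, locMap hP k f ∉ locIdeal hP I →
      ∃ w ∈ F, IsWitness hP I w ∧
        (∃ (K : AddSubgroup (AddUnits (Loc hP))) (ρ : Multiplicative K →* kˣ),
          IsCharAt hP I w ρ) ∧
        ∀ (K : AddSubgroup (AddUnits (Loc hP))) (ρ : Multiplicative K →* kˣ),
          IsCharAt hP I w ρ → f ∉ component hP I ρ {w} := by
  obtain ⟨F, hF, hFs⟩ := exists_finite_support_socleIdeal hP I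
  refine ⟨F, hF, fun f hf hfI => ?_⟩
  obtain ⟨f₁, hf₁, hff₁⟩ := hFs f hf
  obtain ⟨F₀, h₁, hsupp, h₂⟩ := exists_isReduced (locIdeal hP I) (locMap hP k f₁)
  have hdiff : locMap hP k f - F₀ ∈ locIdeal hP I := by
    have := Ideal.add_mem _ hff₁ (binomialPart_le _ h₁)
    rwa [map_sub, sub_add_sub_cancel] at this
  have hne : (F₀.coeff.support : Set (Loc hP)).Nonempty := by
    rw [Finset.coe_nonempty, Finsupp.support_nonempty_iff]
    intro h
    rw [coeff_eq_zero.1 h, sub_zero] at hdiff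
    exact hfI hdiff
  have hkill : ∀ x : Loc hP, ¬ IsAddUnit x → mono k x * F₀ ∈ locIdeal hP I := by
    intro x hx
    have h3 := (mem_socleIdeal_iff hP I).1 hf _ (mono_mem_maxMono hP hx)
    have h4 := Ideal.mul_mem_left _ (mono k x) hdiff
    rw [mul_sub, mul_comm] at h4
    simpa using Ideal.sub_mem _ h3 h4
  -- The product `t^x F₀` vanishes modulo `I_P`, so a nonzero term `t^(x + u)` must be cancelled by
  -- another term of the same class.
  have hpartner : ∀ x : Loc hP, ¬ IsAddUnit x → ∀ u ∈ F₀.coeff.support,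
      mono k (x + u) ∉ locIdeal hP I →
      ∃ v ∈ F₀.coeff.support, v ≠ u ∧ inducedCon (locIdeal hP I) (x + v) (x + u) := by
    intro x hx u hu hxu
    by_contra! hno
    let T : AddMonoidAlgebra k (Loc hP) →ₗ[k] k :=
      classCoeff (locIdeal hP I) (x + u) ∘ₗ LinearMap.mulLeft k (mono k x)
    have hT : ∀ v, T (mono k v) = classCoeff (locIdeal hP I) (x + u) (mono k (x + v)) :=
      fun v => by simp [T, mono_add]
    have h0 : T F₀ = 0 := classCoeff_eq_zero (hI.locIdeal hP) hxu (hkill x hx)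
    rw [linearMap_apply_of_isolated T (u := u), hT] at h0
    · exact mul_ne_zero (Finsupp.mem_support_iff.1 hu) classCoeff_self_ne_zero h0
    · intro v hv hvu
      rw [hT]
      exact classCoeff_mono_eq_zero (hno v hv hvu)
  obtain ⟨w, hw, hmin⟩ := exists_minimal_locLE (I := I) (Finset.finite_toSet _) hne
  have hwI := h₂.mono_notMem w hw
  -- If a nonunit `x` fixed the class of `w`, the partner `v` would satisfy `x + v ∼ w`, so by
  -- minimality `v ∼ d + w`. Then `v ∼ d + x + w ∼ x + v ∼ w`, against reducedness.
  have hgood : ∀ x : Loc hP, ¬ IsAddUnit x → ¬ inducedCon (locIdeal hP I) (x + w) w := by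
    intro x hx hxw
    obtain ⟨v, hv, hvw, hr⟩ := hpartner x hx w hw
      fun h => hwI ((mono_mem_iff_of_rel hxw).1 h)
    have hxv := (inducedCon _).trans hr hxw
    obtain ⟨d, hd⟩ := hmin v hv ⟨x, hxv⟩
    refine hvw (h₂.eq_of_rel v hv w hw ?_)
    have h3 := rel_add_left d hxw
    rw [add_left_comm] at h3
    have h4 := rel_add_left x hd
    exact (inducedCon _).trans ((inducedCon _).symm hd) ((inducedCon _).trans
      ((inducedCon _).symm h3) ((inducedCon _).trans h4 hxv))
  obtain ⟨K, ρ, hρ⟩ := exists_hasChar hwI hgood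
  have hmerged : IsMerged hP I w := by
    intro p hp
    -- If `t^(p + w) ∈ I_P`, the class of `p + w` is nil and itself serves as the class merging with
    -- `w`.
    by_cases hpw : mono k (toLoc hP p + w) ∈ locIdeal hP I
    · exact ⟨toLoc hP p + w, fun h => hwI ((mono_mem_iff_of_rel h).1 hpw),
        rel_of_mono_mem (mono_add_mem _ hpw) hpw⟩
    · obtain ⟨v, hv, hvw, hr⟩ := hpartner _
        (fun hu => (isAddUnit_toLoc_iff hP).1 hu hp) w hw hpw
      exact ⟨v, fun h => hvw (h₂.eq_of_rel v hv w hw h), hr⟩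
  obtain ⟨u, hu, hwu⟩ : ∃ u ∈ f₁.coeff.support, toLoc hP u = w := by
    classical
    have := Finsupp.mapDomain_support (hsupp hw)
    simpa using this
  obtain ⟨a, ha, s, hs, rfl⟩ := hf₁ u hu
  rw [map_add] at hwu
  have hsu := isAddUnit_toLoc hP hs
  have hra : inducedCon (locIdeal hP I) (toLoc hP s + toLoc hP a) w := by
    rw [hwu]; exact (inducedCon _).refl w
  have hρa := hρ.of_associate hsu hra
  refine ⟨a, ha, hρa.isWitness (hmerged.of_associate hsu hra),
    ⟨K, ρ, (isCharAt_iff hI hρa.mono_notMem).2 hρa⟩, fun K' ρ' hρ' hfc => ?_⟩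
  rw [isCharAt_iff hI hρa.mono_notMem] at hρ'
  have hF₀ : F₀ ∈ classKernel (locIdeal hP I) (toLoc hP a) := by
    refine locComponent_le_classKernel hI (Set.mem_singleton a) hρ' ?_
    have := Ideal.sub_mem _ (Ideal.mem_comap.1 hfc) (locIdeal_le_locComponent hP ρ' I {a} hdiff)
    rwa [sub_sub_cancel] at this
  obtain ⟨e, he⟩ := isAddUnit_iff_exists_neg.1 hsu
  -- The witness taken from `F` is `a`, with `w = s + a`; the shift by the inverse `e` of `s` moves
  -- `w` to `a`.
  let T : AddMonoidAlgebra k (Loc hP) →ₗ[k] k :=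
    classCoeff (locIdeal hP I) (toLoc hP a) ∘ₗ LinearMap.mulLeft k (mono k e)
  have hT : ∀ v, T (mono k v) = classCoeff (locIdeal hP I) (toLoc hP a) (mono k (e + v)) :=
    fun v => by simp [T, mono_add]
  have hew : e + w = toLoc hP a := by
    rw [← hwu, ← add_assoc, add_comm e, he, zero_add]
  have h0 : T F₀ = 0 := hF₀ e
  rw [linearMap_apply_of_isolated T (u := w), hT, hew] at h0
  · exact mul_ne_zero (Finsupp.mem_support_iff.1 hw) classCoeff_self_ne_zero h0
  · intro v hv hvw
    rw [hT]
    refine classCoeff_mono_eq_zero fun h => hvw (h₂.eq_of_rel v hv w hw ?_)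
    have h3 := rel_add_left (toLoc hP s) h
    rwa [← add_assoc, he, zero_add, hwu] at h3

variable {I} in
/-- A monomial multiple of an element outside of `I` lies in the socle ideal of some prime, and
outside of the localization of `I`. -/
theorem exists_prime_mem_socleIdeal [AddMonoid.FG Q] {f : AddMonoidAlgebra k Q} (hf : f ∉ I) :
    ∃ (P : Set Q) (hP : IsPrimeIdeal P) (q : Q), mono k q * f ∈ socleIdeal hP I ∧
      locMap hP k (mono k q * f) ∉ locIdeal hP I := by
  have := isNoetherianRing_addMonoidAlgebra (k := k) (Q := Q)
  -- As for associated primes: if neither `t^a` nor `t^b` kills `t^q f` while `t^(a + b)` does, then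
  -- passing to `t^(a + q) f` strictly enlarges the colon ideal.
  obtain ⟨-, ⟨q, hq, rfl⟩, hmax⟩ := set_has_maximal_iff_noetherian.2 this
    ((fun q => I.colon {mono k q * f}) '' {q : Q | mono k q * f ∉ I})
    ⟨_, 0, by simpa [mono_zero] using hf, rfl⟩
  have hP : IsPrimeIdeal {s : Q | mono k s * (mono k q * f) ∈ I} := by
    refine ⟨fun a p hp => ?_, fun a b hab => ?_, ?_⟩
    · change mono k (a + p) * _ ∈ I
      rw [mono_add, mul_assoc]
      exact I.mul_mem_left _ hp
    · by_contra! hno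
      obtain ⟨ha, hb⟩ := hno
      refine hmax _ ⟨a + q, ?_, rfl⟩ (lt_of_le_of_ne (fun g hg => ?_) fun h => hb ?_)
      · change mono k (a + q) * f ∉ I
        rwa [mono_add, mul_assoc]
      · have h1 := Submodule.mem_colon_singleton.1 hg
        refine Submodule.mem_colon_singleton.2 ?_
        have h2 := I.mul_mem_left (mono k a) h1
        rw [smul_eq_mul] at h2 ⊢
        rw [mono_add]
        convert h2 using 1
        ring
      · change mono k b * (mono k q * f) ∈ I
        refine Submodule.mem_colon_singleton.1 (?_ : mono k b ∈ I.colon {mono k q * f})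
        have h' : I.colon {mono k q * f} = I.colon {mono k (a + q) * f} := h
        rw [h', Submodule.mem_colon_singleton, smul_eq_mul]
        have h1 : mono k (a + b) * (mono k q * f) ∈ I := hab
        convert h1 using 1
        rw [mono_add, mono_add]
        ring
    · change mono k 0 * _ ∉ I
      rwa [mono_zero, one_mul]
  refine ⟨_, hP, q, (mem_socleIdeal_iff hP I).2 fun g hg => ?_, fun h => ?_⟩
  · suffices maxMono hP k ≤ (locIdeal hP I).colon {locMap hP k (mono k q * f)} by
      rw [mul_comm (locMap hP k (mono k q * f)) g]
      exact Submodule.mem_colon_singleton.1 (this hg)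
    refine Ideal.span_le.2 ?_
    rintro _ ⟨p, hp, rfl⟩
    refine Submodule.mem_colon_singleton.2 ?_
    have := locMap_mem_locIdeal hP hp
    rwa [map_mul, locMap_mono] at this
  · obtain ⟨s, hs, h1⟩ := (locMap_mem_locIdeal_iff hP).1 h
    exact hs h1

end Separation

/-! ### Finiteness -/

section Finiteness

variable {k : Type*} [Field k] {Q : Type*} [AddCommMonoid Q] [AddMonoid.FG Q]

/-- A prime is determined by the generators of `Q` that it contains. -/
theorem finite_setOf_isPrimeIdeal : {P : Set Q | IsPrimeIdeal P}.Finite := by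
  obtain ⟨S, hS⟩ := (AddMonoid.fg_def (M := Q)).1 inferInstance
  have key : ∀ P P' : Set Q, IsPrimeIdeal P → IsPrimeIdeal P' →
      (P ∩ S ⊆ P' ∩ S) → P ⊆ P' := by
    intro P P' hP hP' h q
    have hq : q ∈ AddSubmonoid.closure (S : Set Q) := hS ▸ AddSubmonoid.mem_top q
    induction hq using AddSubmonoid.closure_induction with
    | mem x hx => exact fun hxP => (h ⟨hxP, hx⟩).1
    | zero => exact fun h0 => absurd h0 hP.zero_notMem
    | add a b _ _ ha hb =>
      intro hab
      rcases hP.mem_or_mem a b hab with h1 | h1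
      · rw [add_comm]; exact hP'.add_mem _ _ (ha h1)
      · exact hP'.add_mem _ _ (hb h1)
  refine Set.Finite.of_finite_image (f := fun P => P ∩ (S : Set Q)) ?_ ?_
  · refine S.finite_toSet.finite_subsets.subset ?_
    rintro _ ⟨P, _, rfl⟩
    exact Set.inter_subset_right
  · intro P hP P' hP' h
    exact Set.Subset.antisymm (key P P' hP hP' h.subset) (key P' P hP' hP h.superset)

/-- A function on `Q` that increases under addition takes finitely many values in a partial order
with the ascending chain condition. -/
theorem finite_range_of_le_add {α : Type*} [PartialOrder α] [WellFoundedGT α] (φ : Q → α)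
    (hφ : ∀ a c, φ a ≤ φ (a + c)) : (Set.range φ).Finite := by
  by_contra hinf
  let e := Set.Infinite.natEmbedding _ hinf
  choose q hq using fun n => (e n).2
  -- Among infinitely many elements with distinct values, Dickson's lemma finds a divisibility
  -- chain, whose values would increase without stabilizing.
  obtain ⟨g, hg⟩ := (wellQuasiOrdered_exists_add (Q := Q)).exists_monotone_subseq q
  have hmono : Monotone fun n => φ (q (g n)) := by
    intro m n hmn
    obtain ⟨c, hc⟩ := hg m n hmn
    change φ (q (g m)) ≤ φ (q (g n))
    rw [hc]
    exact hφ _ _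
  obtain ⟨n, hn⟩ := WellFoundedGT.monotone_chain_condition ⟨_, hmono⟩
  have h1 : φ (q (g n)) = φ (q (g (n + 1))) := hn (n + 1) n.le_succ
  rw [hq, hq] at h1
  have := g.injective (e.injective (Subtype.ext h1))
  omega

theorem finite_assMesoprimes (I : Ideal (AddMonoidAlgebra k Q)) : (assMesoprimes I).Finite := by
  have := isNoetherianRing_addMonoidAlgebra (k := k) (Q := Q)
  have hfin : Finite {P : Set Q | IsPrimeIdeal P} := finite_setOf_isPrimeIdeal.to_subtype
  have hrange : ∀ P : {P : Set Q | IsPrimeIdeal P}, (Set.range (mesoprimeAt P.2 I)).Finite := by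
    intro P
    refine finite_range_of_le_add _ fun a c => Ideal.comap_mono (sup_le_sup_right ?_ _)
    intro f hf
    have h1 := Submodule.mem_colon_singleton.1 hf
    refine Submodule.mem_colon_singleton.2 ?_
    rw [smul_eq_mul] at h1 ⊢
    rw [map_add, mono_add, ← mul_assoc]
    exact Ideal.mul_mem_right _ _ h1
  refine (Set.finite_iUnion hrange).subset ?_
  rintro _ ⟨P, hP, K, ρ, w, -, hρ, rfl⟩
  refine Set.mem_iUnion.2 ⟨⟨P, hP⟩, w, ?_⟩
  rw [mesoprimeAt, mesoprime, hρ.2]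

end Finiteness

/-! ### A mesoprime determines its prime and its stabilizer -/

section Uniqueness

variable {k : Type*} [Field k] {Q : Type*} [AddCommMonoid Q]

theorem prime_eq_of_mesoprime_eq {P P' : Set Q} {hP : IsPrimeIdeal P} {hP' : IsPrimeIdeal P'}
    {K : AddSubgroup (AddUnits (Loc hP))} {ρ : Multiplicative K →* kˣ}
    {K' : AddSubgroup (AddUnits (Loc hP'))} {ρ' : Multiplicative K' →* kˣ}
    (h : mesoprime hP ρ = mesoprime hP' ρ') : P = P' := by
  ext q
  rw [← mono_mem_mesoprime_iff (hP := hP) (ρ := ρ), h, mono_mem_mesoprime_iff]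

/-- Lets a witness be filed under whichever character was chosen to represent its mesoprime. -/
theorem IsCharAt.of_mesoprime_eq {P : Set Q} {hP : IsPrimeIdeal P}
    {I : Ideal (AddMonoidAlgebra k Q)} {w : Q}
    {K K' : AddSubgroup (AddUnits (Loc hP))} {ρ : Multiplicative K →* kˣ}
    {ρ' : Multiplicative K' →* kˣ} (h : IsCharAt hP I w ρ')
    (heq : mesoprime hP ρ = mesoprime hP ρ') : IsCharAt hP I w ρ := by
  have h1 := comap_locMap_injective hP heq
  refine ⟨?_, h1.trans h.2⟩
  rw [← h.1]
  exact le_antisymm (charIdeal_sup_maxMono_inj h1) (charIdeal_sup_maxMono_inj h1.symm)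

end Uniqueness

end

end Mesoprimary

/-! ### Assembling the decomposition -/

open Mesoprimary

theorem corollaryc {k : Type*} [Field k] {Q : Type*} [AddCommMonoid Q] [AddMonoid.FG Q]
    (I : Ideal (AddMonoidAlgebra k Q)) (hI : Mesoprimary.IsBinomialIdeal I) :
    ∃ J : Mesoprimary.assMesoprimes I → Ideal (AddMonoidAlgebra k Q),
      Mesoprimary.IsCombinatorialDecomposition I J ∧
      ∀ p : Mesoprimary.assMesoprimes I,
        Mesoprimary.assMesoprimes (J p) = {(p : Ideal (AddMonoidAlgebra k Q))} ∧
        ∃ (P : Set Q) (hP : Mesoprimary.IsPrimeIdeal P)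
          (K : AddSubgroup (AddUnits (Mesoprimary.Loc hP))) (ρ : Multiplicative K →* kˣ)
          (W : Set Q),
          Mesoprimary.IsPMesoprimary P (J p) ∧
          (p : Ideal (AddMonoidAlgebra k Q)) = Mesoprimary.mesoprime hP ρ ∧
          W.Finite ∧ W.Nonempty ∧
          (∀ w ∈ W, Mesoprimary.IsWitness hP I w ∧ Mesoprimary.IsCharAt hP I w ρ) ∧
          J p = Mesoprimary.component hP I ρ W ∧
          J p = ⨅ w ∈ W, Mesoprimary.component hP I ρ {w} := by
  choose F hF hsep using fun (P : Set Q) (hP : IsPrimeIdeal P) =>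
    exists_finite_separating hP I hI
  choose P hP K ρ w₀ hw₀ hρ₀ hp using fun p : assMesoprimes I => p.2
  -- The finite sets `F` supply the separating witnesses; `w₀ p` is inserted so that every
  -- associated mesoprime has a nonempty set of cogenerators.
  let W : assMesoprimes I → Set Q := fun p =>
    insert (w₀ p) {w ∈ F (P p) (hP p) | IsWitness (hP p) I w ∧ IsCharAt (hP p) I w (ρ p)}
  have hfin : ∀ p, (W p).Finite := fun p => ((hF _ _).subset (Set.sep_subset _ _)).insert _
  have hne : ∀ p, (W p).Nonempty := fun p => Set.insert_nonempty _ _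
  have hwit : ∀ p, ∀ w ∈ W p, IsWitness (hP p) I w ∧ IsCharAt (hP p) I w (ρ p) := by
    rintro p w (rfl | hw)
    · exact ⟨hw₀ p, hρ₀ p⟩
    · exact hw.2
  have hchar : ∀ p, ∀ w ∈ W p, HasChar (hP p) (ρ p) I (toLoc (hP p) w) := fun p w hw =>
    (isCharAt_iff hI (hwit p w hw).1.1).1 (hwit p w hw).2
  have hmeso : ∀ p, IsPMesoprimary (P p) (component (hP p) I (ρ p) (W p)) := fun p =>
    isPMesoprimary_component hI (hfin p) (hne p) (hchar p)
  refine ⟨fun p => component (hP p) I (ρ p) (W p), ⟨⟨?_, ?_, fun p => (hmeso p).1, ?_⟩, ?_⟩,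
    fun p => ⟨?_, P p, hP p, K p, ρ p, W p, hmeso p, hp p, hfin p, hne p, hwit p, rfl,
      component_eq_iInf hI (hchar p)⟩⟩
  · exact (finite_assMesoprimes I).to_subtype
  · refine le_antisymm (le_iInf fun p => le_component _ _ _ _) fun f hf => ?_
    by_contra hfI
    obtain ⟨P', hP', q, hq, hq'⟩ := exists_prime_mem_socleIdeal hfI
    obtain ⟨w, hwF, hww, ⟨K', ρ', hρ'⟩, hno⟩ := hsep P' hP' _ hq hq'
    -- The prime and character chosen for this mesoprime need not be literally `P'` and `ρ'`.
    -- Stating the claim for arbitrary data with the same mesoprime allows `P₁` to be replaced by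
    -- `P'`.
    have key : ∀ (P₁ : Set Q) (hP₁ : IsPrimeIdeal P₁) (K₁ : AddSubgroup (AddUnits (Loc hP₁)))
        (ρ₁ : Multiplicative K₁ →* kˣ), mesoprime hP' ρ' = mesoprime hP₁ ρ₁ →
        (w ∈ F P₁ hP₁ ∧ IsWitness hP₁ I w ∧ IsCharAt hP₁ I w ρ₁) ∧
          mono k q * f ∉ component hP₁ I ρ₁ {w} := by
      intro P₁ hP₁ K₁ ρ₁ h
      obtain rfl := prime_eq_of_mesoprime_eq h
      have hρ₁ := hρ'.of_mesoprime_eq h.symm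
      exact ⟨⟨hwF, hww, hρ₁⟩, hno K₁ ρ₁ hρ₁⟩
    let p : assMesoprimes I := ⟨mesoprime hP' ρ', P', hP', K', ρ', w, hww, hρ', rfl⟩
    obtain ⟨hwW, hnot⟩ := key (P p) (hP p) (K p) (ρ p) (hp p)
    have hwp : {w} ⊆ W p := Set.singleton_subset_iff.2 (Set.mem_insert_of_mem _ hwW)
    exact hnot (Ideal.comap_mono (locComponent_anti hwp)
      (Ideal.mul_mem_left _ _ ((Ideal.mem_iInf.1 hf) p)))
  · intro p P' hP' hJ w hw
    obtain rfl : P' = P p := hJ.2.trans (hmeso p).2.symm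
    exact mesoprimeAt_eq_of_inSocle hI (hchar p) hw
  · intro p P' hP' hJ w hw
    obtain rfl : P' = P p := hJ.2.trans (hmeso p).2.symm
    exact isWitness_of_inSocle hI (hchar p) (fun w hw => (hwit p w hw).1) hw
  · rw [assMesoprimes_component hI (hfin p) (hne p) (hchar p), ← hp p]
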